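/- Let $M$ be a closed (that is, compact, connected, without boundary) smooth Riemannian manifold of dimension $n$, and let $\widetilde M$ be its universal cover with the lifted Riemannian metric. Let $x\in M$, let $k\ge 0$, and let $c_1,\dots,c_k$ be loops of finite length based at $x$ that are homotopically independent, meaning that their homotopy classes generate a subgroup of $\pi_1(M,x)$ that is free of rank $k$. Then the volume entropy of $M$, that is, the limit $$h_{\mathrm{vol}}(M)=\lim_{R\to\infty}\frac{\log \operatorname{vol} B(\tilde x,R)}{R},$$ where $B(\tilde x,R)$ is the metric ball of radius $R$ around $\tilde x$ in $\widetilde M$ and $\operatorname{vol}$ is the Riemannian volume, exists as a real number and is the same for every $\tilde x\in\widetilde M$, and $$\sum_{i=1}^k \frac{1}{1+e^{h_{\mathrm{vol}}(M)\,\ell(c_i)}}\le \frac12,$$ where $\ell(c_i)$ denotes the length of $c_i$. -/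

import Mathlib

open Set Filter Topology MeasureTheory Manifold Bundle
open scoped ENNReal ContDiff unitInterval

/-- The length of a continuous path in a metric space: the supremum of the lengths of inscribed
polygons. -/
noncomputable def pathLength {X : Type*} [PseudoEMetricSpace X] {x y : X} (γ : Path x y) : ℝ≥0∞ :=
  eVariationOn γ univ

section PathLength

variable {X : Type*} [PseudoEMetricSpace X] {x y z : X}

theorem pathLength_refl (x : X) : pathLength (Path.refl x) = 0 := by
  unfold pathLength
  apply eVariationOn.constant_on
  rintro _ ⟨s, -, rfl⟩ _ ⟨t, -, rfl⟩
  simp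

theorem pathLength_symm (γ : Path x y) : pathLength γ.symm = pathLength γ := by
  unfold pathLength
  have h : (⇑γ.symm) = γ ∘ σ := rfl
  rw [h, eVariationOn.comp_eq_of_antitoneOn _ _ (fun a _ b _ hab => unitInterval.symm_le_symm.2 hab),
    image_univ, (Function.Involutive.surjective unitInterval.symm_symm).range_eq]

theorem pathLength_eq_extend (γ : Path x y) :
    pathLength γ = eVariationOn γ.extend (Icc (0 : ℝ) 1) := by
  unfold pathLength
  have h : (⇑γ) = γ.extend ∘ ((↑) : I → ℝ) := by
    ext t; simp
  conv_lhs => rw [h]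
  rw [eVariationOn.comp_eq_of_monotoneOn γ.extend ((↑) : I → ℝ) (fun a _ b _ hab => hab), image_univ,
    Subtype.range_coe]

theorem pathLength_trans (γ : Path x y) (δ : Path y z) :
    pathLength (γ.trans δ) = pathLength γ + pathLength δ := by
  simp only [pathLength_eq_extend]
  have h := eVariationOn.Icc_add_Icc (γ.trans δ).extend (s := univ) (a := (0 : ℝ)) (b := 1 / 2)
    (c := 1) (by norm_num) (by norm_num) (mem_univ _)
  simp only [univ_inter] at h
  rw [← h]
  congr 1
  · have e : EqOn (γ.trans δ).extend (γ.extend ∘ fun t => 2 * t) (Icc (0 : ℝ) (1 / 2)) :=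
      fun t ht => Path.extend_trans_of_le_half _ _ ht.2
    rw [eVariationOn.eq_of_eqOn e, eVariationOn.comp_eq_of_monotoneOn]
    · congr 1
      ext t
      constructor
      · rintro ⟨s, hs, rfl⟩
        exact ⟨by linarith [hs.1], by linarith [hs.2]⟩
      · intro ht
        exact ⟨t / 2, ⟨by linarith [ht.1], by linarith [ht.2]⟩, by ring⟩
    · intro a _ b _ hab
      dsimp only
      linarith
  · have e : EqOn (γ.trans δ).extend (δ.extend ∘ fun t => 2 * t - 1) (Icc (1 / 2 : ℝ) 1) :=
      fun t ht => Path.extend_trans_of_half_le _ _ ht.1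
    rw [eVariationOn.eq_of_eqOn e, eVariationOn.comp_eq_of_monotoneOn]
    · congr 1
      ext t
      constructor
      · rintro ⟨s, hs, rfl⟩
        exact ⟨by linarith [hs.1], by linarith [hs.2]⟩
      · intro ht
        exact ⟨(t + 1) / 2, ⟨by linarith [ht.1], by linarith [ht.2]⟩, by ring⟩
    · intro a _ b _ hab
      dsimp only
      linarith

theorem edist_le_pathLength (γ : Path x y) (t : I) : edist (γ t) x ≤ pathLength γ := by
  have h := eVariationOn.edist_le γ (s := univ) (mem_univ t) (mem_univ (0 : I))
  rwa [γ.source] at h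

end PathLength

/-- In a manifold, every loop that stays close to its base point is null-homotopic. -/
theorem exists_nhds_loop_homotopic_refl (n : ℕ) {M : Type*} [TopologicalSpace M]
    [ChartedSpace (EuclideanSpace ℝ (Fin n)) M] (y : M) :
    ∃ U ∈ 𝓝 y, ∀ γ : Path y y, (∀ t, γ t ∈ U) → γ.Homotopic (Path.refl y) := by
  set e := chartAt (EuclideanSpace ℝ (Fin n)) y with he
  have hy : y ∈ e.source := mem_chart_source _ y
  obtain ⟨ε, hε, hball⟩ := Metric.isOpen_iff.1 e.open_target (e y) (e.map_source hy)
  refine ⟨e.source ∩ e ⁻¹' Metric.ball (e y) ε,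
    (e.isOpen_inter_preimage Metric.isOpen_ball).mem_nhds ⟨hy, Metric.mem_ball_self hε⟩, ?_⟩
  intro γ hγ
  have hec : Continuous fun t => e (γ t) :=
    e.continuousOn.comp_continuous γ.continuous fun t => (hγ t).1
  have hmem : ∀ p : I × I,
      AffineMap.lineMap (e (γ p.2)) (e y) (p.1 : ℝ) ∈ Metric.ball (e y) ε := fun p =>
    (convex_ball (e y) ε).lineMap_mem (hγ p.2).2 (Metric.mem_ball_self hε) p.1.2
  refine ⟨⟨⟨⟨fun p => e.symm (AffineMap.lineMap (e (γ p.2)) (e y) (p.1 : ℝ)), ?_⟩, ?_, ?_⟩, ?_⟩⟩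
  · refine e.continuousOn_symm.comp_continuous ?_ fun p => hball (hmem p)
    simp only [AffineMap.lineMap_apply_module]
    have h1 : Continuous fun p : I × I => e (γ p.2) := hec.comp continuous_snd
    have h2 : Continuous fun p : I × I => (p.1 : ℝ) := by fun_prop
    exact ((continuous_const.sub h2).smul h1).add (h2.smul continuous_const)
  · intro t
    simp [e.left_inv (hγ t).1]
  · intro t
    simp [e.left_inv hy]
  · intro s t ht
    have : γ t = y := by
      rcases ht with rfl | ht
      · exact γ.source
      · rw [mem_singleton_iff.1 ht]; exact γ.target
    simp [this, e.left_inv hy]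

/-- The universal cover of a connected `n`-manifold `M` with base point `x`, in its classical
construction: the points over `y` are the homotopy classes, with fixed endpoints, of paths from `x`
to `y`. -/
structure UniversalCover (n : ℕ) {M : Type*} [TopologicalSpace M]
    [ChartedSpace (EuclideanSpace ℝ (Fin n)) M] (x : M) where
  /-- the covering projection -/
  proj : M
  /-- the homotopy class of paths from the base point -/
  cls : Path.Homotopic.Quotient x proj

namespace UniversalCover

variable {n : ℕ} {M : Type*} [EMetricSpace M] [ChartedSpace (EuclideanSpace ℝ (Fin n)) M] {x : M}

/-- The distance on the universal cover for the lifted metric: the infimum of the lengths of the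
curves in the universal cover from `a` to `b`. By unique path lifting, these curves are the lifts
of the paths `γ` in `M` that carry the class `a` to the class `b`, and a lift has the same
length as `γ`. -/
noncomputable def coverEDist (a b : UniversalCover n x) : ℝ≥0∞ :=
  ⨅ (γ : Path a.proj b.proj)
    (_ : a.cls.trans (Path.Homotopic.Quotient.mk γ) = b.cls), pathLength γ

theorem coverEDist_self (a : UniversalCover n x) : coverEDist a a = 0 := by
  refine le_antisymm ?_ bot_le
  refine (iInf₂_le (Path.refl a.proj) ?_).trans_eq (pathLength_refl _)
  rw [Path.Homotopic.Quotient.mk_refl, Path.Homotopic.Quotient.trans_refl]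

theorem coverEDist_comm_le (a b : UniversalCover n x) : coverEDist a b ≤ coverEDist b a := by
  refine le_iInf₂ fun γ hγ => (iInf₂_le γ.symm ?_).trans_eq (pathLength_symm γ)
  rw [← hγ, Path.Homotopic.Quotient.mk_symm, Path.Homotopic.Quotient.trans_assoc,
    Path.Homotopic.Quotient.trans_symm, Path.Homotopic.Quotient.trans_refl]

theorem coverEDist_triangle (a b c : UniversalCover n x) :
    coverEDist a c ≤ coverEDist a b + coverEDist b c := by
  unfold coverEDist
  simp only [ENNReal.iInf_add, ENNReal.add_iInf]
  refine le_iInf₂ fun δ hδ => le_iInf₂ fun γ hγ => ?_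
  refine (iInf₂_le (γ.trans δ) ?_).trans_eq (pathLength_trans γ δ)
  rw [Path.Homotopic.Quotient.mk_trans, ← Path.Homotopic.Quotient.trans_assoc, hγ, hδ]

theorem eq_of_coverEDist_eq_zero (a b : UniversalCover n x) (h : coverEDist a b = 0) : a = b := by
  have hp : a.proj = b.proj := by
    refine eq_of_edist_eq_zero (le_antisymm ?_ bot_le)
    rw [← h]
    refine le_iInf₂ fun γ _ => ?_
    have := edist_le_pathLength γ 1
    rwa [γ.target, edist_comm] at this
  obtain ⟨y, P⟩ := a
  obtain ⟨z, Q⟩ := b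
  obtain rfl : y = z := hp
  obtain ⟨U, hU, hnull⟩ := exists_nhds_loop_homotopic_refl n y
  obtain ⟨ε, hε, hball⟩ := EMetric.mem_nhds_iff.1 hU
  have hlt : coverEDist (⟨y, P⟩ : UniversalCover n x) ⟨y, Q⟩ < ε := h ▸ hε
  unfold coverEDist at hlt
  simp only [iInf_lt_iff] at hlt
  obtain ⟨γ, hγ, hlen⟩ := hlt
  have hγ0 : Path.Homotopic.Quotient.mk γ = Path.Homotopic.Quotient.refl y := by
    rw [← Path.Homotopic.Quotient.mk_refl, Path.Homotopic.Quotient.eq]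
    exact hnull γ fun t => hball ((edist_le_pathLength γ t).trans_lt hlen)
  have hPQ : P = Q := by
    rw [← hγ]
    simp only [hγ0, Path.Homotopic.Quotient.trans_refl]
  rw [hPQ]

noncomputable instance instEMetricSpace : EMetricSpace (UniversalCover n x) where
  edist := coverEDist
  edist_self := coverEDist_self
  edist_comm a b := le_antisymm (coverEDist_comm_le a b) (coverEDist_comm_le b a)
  edist_triangle := coverEDist_triangle
  eq_of_edist_eq_zero {a b} h := eq_of_coverEDist_eq_zero a b h

noncomputable instance instMeasurableSpace : MeasurableSpace (UniversalCover n x) := borel _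

instance instBorelSpace : BorelSpace (UniversalCover n x) := ⟨rfl⟩

/-- The Riemannian volume on the universal cover of an `n`-dimensional Riemannian manifold: the
`n`-dimensional Hausdorff measure of its Riemannian distance, normalized to agree with Lebesgue
measure on Euclidean `n`-space. -/
noncomputable def vol : Measure (UniversalCover n x) := μHE[n]

end UniversalCover

/-- `h` is the volume entropy of the `n`-dimensional Riemannian manifold `M`: around every point
of the universal cover, for every base point of `M` used to construct it,
`log (vol (B(p, R))) / R` tends to `h` as `R → ∞`. The logarithm is the extended
one, so a ball of infinite volume would have logarithm `⊤` and not a conventional real value. -/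
def HasVolumeEntropy (n : ℕ) (M : Type*) [EMetricSpace M]
    [ChartedSpace (EuclideanSpace ℝ (Fin n)) M] (h : ℝ) : Prop :=
  ∀ (x : M) (p : UniversalCover n x),
    Tendsto (fun R : ℝ => ENNReal.log (UniversalCover.vol (Metric.eball p (ENNReal.ofReal R))) /
      (R : EReal)) atTop (𝓝 (h : EReal))

/-- Loops `c i` based at `x` are homotopically independent if their homotopy classes generate a
free subgroup of rank `k` of the fundamental group. -/
def HomotopicallyIndependent {X : Type*} [TopologicalSpace X] {x : X} {k : ℕ}
    (c : Fin k → Path x x) : Prop :=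
  Nonempty (Subgroup.closure (Set.range fun i : Fin k =>
    FundamentalGroup.fromPath (Path.Homotopic.Quotient.mk (c i))) ≃* FreeGroup (Fin k))

/-!
The counting function of the fundamental group links both halves of the theorem. For a class `g` of
loops at `x`, let its displacement be the infimum of the lengths of loops in `g`, that is, the
distance between the lift of `x` and its translate by `g`, and let `N R` be the number of classes of
displacement less than `R`.

*Existence of the entropy.* The cover is a length space and, for `D` larger than the diameter of
`M`, every point lies within `D` of the orbit of the lifted base point. Cutting a short path from
the base point to an orbit point therefore gives `N (R + S) ≤ N (R + D) * N (S + D)`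
(`ncard_shortClasses_add_le`), so `log (N R) / R` converges by Fekete's lemma
(`exists_tendsto_div_of_subadditive_shift`). Disjoint small balls around orbit points, respectively
a covering by balls of radius `D` around them, bound the volume of a ball of radius `R` below and
above by a constant times `N (R ± const)`, so the volume has the same growth rate
(`exists_tendsto_and_hasVolumeEntropy`). This needs balls of the cover to have finite and positive
volume. Small balls do because charts are locally bi-Lipschitz for the Riemannian distance and the
projection is isometric on balls of a uniform radius (`edist_eq_edist_proj`); larger balls are
totally bounded, by induction on the radius (`totallyBounded_eball`).

*The inequality.* Free groups of finite rank are Hopfian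
(`FreeGroup.injective_of_surjective_endomorphism`), so homotopically independent loops freely
generate a free group `F` in the fundamental group. For `s > h` the Poincaré series
`W = ∑ exp (-s * displacement w)` over `F` converges. Let `W a` be its part over the words with first
letter `a`, and let `z = exp (-s * ℓ)` for the loop of length `ℓ` belonging to `a`. Displacement is
subadditive, so `W a ≥ z * (W - W a⁻¹)`, and summing over all letters gives
`∑ z / (1 + z) < 1 / 2` (`FreeGroup.sum_div_one_add_lt_of_tsum_ne_top`). Finally `s` tends to `h`.
-/

/-! ### Charts of a Riemannian manifold are locally bi-Lipschitz -/

section ChartLipschitz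

open Metric
open scoped NNReal

variable {E : Type*} [NormedAddCommGroup E] [NormedSpace ℝ E]
  {H : Type*} [TopologicalSpace H] (J : ModelWithCorners ℝ E H)
  {M : Type*} [TopologicalSpace M] [ChartedSpace H M]
  [RiemannianBundle (fun x : M => TangentSpace J x)]
  [IsManifold J 1 M]

/-- A chart with derivative bounded by `C` along a curve increases its length by a factor at most
`C`. -/
theorem edist_extChartAt_le_pathELength {x : M} {C : ℝ≥0} {γ : ℝ → M}
    (hγ : CMDiff[Icc 0 1] 1 γ) (hs : ∀ t ∈ Icc (0 : ℝ) 1, γ t ∈ (chartAt H x).source)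
    (hC : ∀ t ∈ Icc (0 : ℝ) 1, ∀ v : TangentSpace J (γ t),
      @enorm E _ (mfderiv% (extChartAt J x) (γ t) v) ≤ C * ‖v‖ₑ) :
    edist (extChartAt J x (γ 0)) (extChartAt J x (γ 1)) ≤ C * pathELength J γ 0 1 := by
  let γ' := extChartAt J x ∘ γ
  have hγ' : CMDiff[Icc 0 1] 1 γ' :=
    contMDiffOn_extChartAt.comp (I' := J) (t := (chartAt H x).source) hγ hs
  rw [edist_comm, edist_eq_enorm_sub]
  calc
    ‖γ' 1 - γ' 0‖ₑ
    _ ≤ ∫⁻ t' in Icc 0 1, ‖derivWithin γ' (Icc 0 1) t'‖ₑ := by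
      apply enorm_sub_le_lintegral_derivWithin_Icc_of_contDiffOn_Icc _ zero_le_one
      rwa [← contMDiffOn_iff_contDiffOn]
    _ = ∫⁻ t' in Icc 0 1, @enorm E _ (mfderiv[Icc 0 1] γ' t' 1) := by
      simp_rw [← fderivWithin_derivWithin, mfderivWithin_eq_fderivWithin]
      rfl
    _ ≤ ∫⁻ t' in Icc 0 1, C * ‖mfderiv[Icc 0 1] γ t' 1‖ₑ := by
      apply setLIntegral_mono' measurableSet_Icc (fun t' ht' ↦ ?_)
      have h1 : mfderiv[Icc 0 1] γ' t' =
          (mfderiv% (extChartAt J x) (γ t')) ∘L (mfderiv[Icc 0 1] γ t') := by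
        apply mfderiv_comp_mfderivWithin
        · exact mdifferentiableAt_extChartAt (hs t' ht')
        · exact hγ.mdifferentiableOn one_ne_zero _ ht'
        · rw [uniqueMDiffWithinAt_iff_uniqueDiffWithinAt]
          exact uniqueDiffOn_Icc zero_lt_one _ ht'
      have h2 : mfderiv[Icc 0 1] γ' t' 1 =
          (mfderiv% (extChartAt J x) (γ t')) (mfderiv[Icc 0 1] γ t' 1) :=
        congr($h1 1)
      rw [h2]
      exact hC t' ht' _
    _ = C * pathELength J γ 0 1 := by
      rw [lintegral_const_mul' _ _ ENNReal.coe_ne_top,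
          pathELength_eq_lintegral_mfderivWithin_Icc]

variable [IsContinuousRiemannianBundle E (fun x : M => TangentSpace J x)]

theorem eventually_enorm_mfderivWithin_symm_extChartAt_apply_le (x : M) :
    ∃ C : ℝ≥0, ∀ᶠ y in 𝓝[range J] (extChartAt J x x), ∀ v : E,
      ‖mfderiv[range J] (extChartAt J x).symm y v‖ₑ ≤ C * ‖v‖ₑ := by
  obtain ⟨C, -, hC⟩ := eventually_enorm_mfderivWithin_symm_extChartAt_lt J x
  refine ⟨C, ?_⟩
  filter_upwards [hC] with y hy v
  exact (ContinuousLinearMap.le_opENorm (E := E)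
    (F := TangentSpace J ((extChartAt J x).symm y)) _ v).trans (mul_le_mul_left hy.le _)

/-- The derivative of a chart is locally bounded; its values are measured in the norm of the model
space `E`. -/
theorem eventually_enorm_mfderiv_extChartAt_apply_le (x : M) :
    ∃ C : ℝ≥0, ∀ᶠ y in 𝓝 x, ∀ v : TangentSpace J y,
      @enorm E _ (mfderiv% (extChartAt J x) y v) ≤ C * ‖v‖ₑ := by
  obtain ⟨C, -, hC⟩ := eventually_enorm_mfderiv_extChartAt_lt J x
  refine ⟨C, ?_⟩
  filter_upwards [hC] with y hy v
  exact (ContinuousLinearMap.le_opENorm (F := E) (E := TangentSpace J y) _ v).trans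
    (mul_le_mul_left hy.le _)

/-- The inverse of a chart is locally Lipschitz: push segments of the chart to the manifold. -/
theorem exists_nhds_riemannianEDist_le_edist_extChartAt (x : M) :
    ∃ C : ℝ≥0, ∃ U ∈ 𝓝 x, ∀ y ∈ U, ∀ z ∈ U,
      riemannianEDist J y z ≤ C * edist (extChartAt J x y) (extChartAt J x z) := by
  obtain ⟨C, hC⟩ := eventually_enorm_mfderivWithin_symm_extChartAt_apply_le J x
  obtain ⟨r, r_pos, hr⟩ : ∃ r > 0,
      ball (extChartAt J x x) r ∩ range J ⊆ (extChartAt J x).target ∩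
        {y | ∀ v : E, ‖mfderiv[range J] (extChartAt J x).symm y v‖ₑ ≤ C * ‖v‖ₑ} :=
    mem_nhdsWithin_iff.1 (inter_mem (extChartAt_target_mem_nhdsWithin x) hC)
  have A : (extChartAt J x) ⁻¹' (ball (extChartAt J x x) r ∩ range J) ∈ 𝓝 x := by
    apply extChartAt_preimage_mem_nhds_of_mem_nhdsWithin (by simp)
    rw [inter_comm]
    exact inter_mem_nhdsWithin _ (ball_mem_nhds _ r_pos)
  refine ⟨C, _, inter_mem A (chart_source_mem_nhds H x), ?_⟩
  intro y hy z hz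
  let η := ContinuousAffineMap.lineMap (R := ℝ) (extChartAt J x y) (extChartAt J x z)
  set γ := (extChartAt J x).symm ∘ η
  have hη : Icc 0 1 ⊆ ⇑η ⁻¹' ((extChartAt J x).target ∩
        {y | ∀ v : E, ‖mfderiv[range J] (extChartAt J x).symm y v‖ₑ ≤ C * ‖v‖ₑ}) := by
    simp only [← image_subset_iff, ContinuousAffineMap.coe_lineMap_eq,
     ← segment_eq_image_lineMap, η]
    apply Subset.trans _ hr
    exact ((convex_ball _ _).inter J.convex_range).segment_subset hy.1 hz.1
  simp only [preimage_inter, subset_inter_iff] at hη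
  have η_smooth : CMDiff[Icc 0 1] 1 η := by
    apply ContMDiff.contMDiffOn
    rw [contMDiff_iff_contDiff]
    exact ContinuousAffineMap.contDiff _
  have hle : riemannianEDist J y z ≤ pathELength J γ 0 1 := by
    apply riemannianEDist_le_pathELength _ _ _ zero_le_one
    · exact (contMDiffOn_extChartAt_symm x).comp η_smooth hη.1
    · simp [γ, η, ContinuousAffineMap.coe_lineMap_eq, hy.2]
    · simp [γ, η, ContinuousAffineMap.coe_lineMap_eq, hz.2]
  apply hle.trans
  rw [← lintegral_fderiv_lineMap_eq_edist, pathELength_eq_lintegral_mfderivWithin_Icc,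
    ← lintegral_const_mul' _ _ ENNReal.coe_ne_top]
  apply setLIntegral_mono' measurableSet_Icc (fun t ht ↦ ?_)
  have h1 : mfderiv[Icc 0 1] γ t =
      (mfderiv[range J] (extChartAt J x).symm (η t)) ∘L (mfderiv[Icc 0 1] η t) := by
    apply mfderivWithin_comp
    · exact mdifferentiableWithinAt_extChartAt_symm (hη.1 ht)
    · exact η_smooth.mdifferentiableOn one_ne_zero t ht
    · exact hη.1.trans (preimage_mono (extChartAt_target_subset_range x))
    · rw [uniqueMDiffWithinAt_iff_uniqueDiffWithinAt]
      exact uniqueDiffOn_Icc zero_lt_one t ht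
  have h2 : mfderiv[Icc 0 1] γ t 1 =
      (mfderiv[range J] (extChartAt J x).symm (η t)) (mfderiv[Icc 0 1] η t 1) := congr($h1 1)
  rw [h2]
  refine (hη.2 ht _).trans (le_of_eq ?_)
  rw [mfderivWithin_eq_fderivWithin]
  rfl

end ChartLipschitz

section LengthSpace

open Metric
open scoped NNReal

variable {E : Type*} [NormedAddCommGroup E] [NormedSpace ℝ E]
  {H : Type*} [TopologicalSpace H] (J : ModelWithCorners ℝ E H)
  {M : Type*} [EMetricSpace M] [ChartedSpace H M]
  [RiemannianBundle (fun x : M => TangentSpace J x)]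

theorem edist_le_pathELength_of_mem_Icc [IsRiemannianManifold J M] {γ : ℝ → M}
    (hγ : CMDiff[Icc 0 1] 1 γ) {s t : ℝ} (hs : 0 ≤ s) (hst : s ≤ t) (ht : t ≤ 1) : edist (γ s) (γ t) ≤ pathELength J γ s t := by
  rw [(IsRiemannianManifold.out (γ s) (γ t) : _ = riemannianEDist J _ _)]
  exact riemannianEDist_le_pathELength (hγ.mono (Icc_subset_Icc hs ht)) rfl rfl hst

/-- A chart of a Riemannian manifold is locally Lipschitz: two points close to `x` are joined by a
short curve, which stays in the region where the derivative of the chart is bounded. -/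
theorem exists_nhds_edist_extChartAt_le [IsRiemannianManifold J M] [IsManifold J 1 M]
    [IsContinuousRiemannianBundle E (fun x : M => TangentSpace J x)] (x : M) :
    ∃ C : ℝ≥0, ∃ U ∈ 𝓝 x, ∀ y ∈ U, ∀ z ∈ U,
      edist (extChartAt J x y) (extChartAt J x z) ≤ C * edist y z := by
  obtain ⟨C, hC⟩ := eventually_enorm_mfderiv_extChartAt_apply_le J x
  obtain ⟨ε, hε, hball⟩ := EMetric.mem_nhds_iff.1 (inter_mem hC (chart_source_mem_nhds H x))
  have hε3 : 0 < ε / 3 := ENNReal.div_pos hε.ne' (by simp)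
  refine ⟨C, eball x (ε / 3), eball_mem_nhds x hε3, fun y hy z hz => ?_⟩
  have hyz : edist y z < ε / 3 + ε / 3 :=
    (edist_triangle_right y z x).trans_lt (ENNReal.add_lt_add hy hz)
  -- it suffices to bound the left side by `C * r` for `r` slightly larger than `edist y z`
  have hT : Tendsto (fun r : ℝ≥0∞ => C * r) (𝓝[>] (edist y z)) (𝓝 (C * edist y z)) :=
    (ENNReal.Tendsto.const_mul tendsto_id (Or.inr ENNReal.coe_ne_top)).mono_left
      nhdsWithin_le_nhds
  have : (𝓝[>] (edist y z)).NeBot := nhdsGT_neBot_of_exists_gt ⟨_, hyz⟩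
  refine ge_of_tendsto hT ?_
  filter_upwards [Ioo_mem_nhdsGT hyz] with r hr
  have hlt := hr.1
  rw [(IsRiemannianManifold.out y z : _ = riemannianEDist J _ _)] at hlt
  obtain ⟨γ, rfl, rfl, hγ, hlt⟩ := exists_lt_of_riemannianEDist_lt hlt
  have hmem : ∀ t ∈ Icc (0 : ℝ) 1, γ t ∈ eball x ε := fun t ht => by
    have h1 : edist (γ t) (γ 0) < ε / 3 + ε / 3 := by
      rw [edist_comm]
      exact (edist_le_pathELength_of_mem_Icc J hγ le_rfl ht.1 ht.2).trans_lt
        ((pathELength_mono le_rfl ht.2).trans_lt (hlt.trans hr.2))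
    calc edist (γ t) x ≤ edist (γ t) (γ 0) + edist (γ 0) x := edist_triangle _ _ _
      _ < ε / 3 + ε / 3 + ε / 3 := ENNReal.add_lt_add h1 hy
      _ = ε := ENNReal.add_thirds ε
  refine (edist_extChartAt_le_pathELength J hγ (fun t ht => (hball (hmem t ht)).2)
    (fun t ht => (hball (hmem t ht)).1)).trans ?_
  gcongr

/-- A Riemannian manifold is a length space. -/
theorem exists_path_pathLength_lt [IsRiemannianManifold J M] {x y : M} {r : ℝ≥0∞}
    (h : edist x y < r) : ∃ γ : Path x y, pathLength γ < r := by
  rw [(IsRiemannianManifold.out x y : _ = riemannianEDist J _ _)] at h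
  obtain ⟨γ, rfl, rfl, hγ, hlt⟩ := exists_lt_of_riemannianEDist_lt h
  have hcont : Continuous fun t : I => γ t := hγ.continuousOn.comp_continuous
    continuous_subtype_val fun t => t.2
  refine ⟨⟨⟨fun t => γ t, hcont⟩, by simp, by simp⟩, lt_of_le_of_lt ?_ hlt⟩
  refine iSup_le fun ⟨m, u, hu, _⟩ => ?_
  have hsum : ∀ m : ℕ, ∑ i ∈ Finset.range m, edist (γ (u (i + 1))) (γ (u i)) ≤
      pathELength J γ (u 0) (u m) := by
    intro m
    induction m with
    | zero => simp
    | succ m ih =>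
      rw [Finset.sum_range_succ, ← pathELength_add (b := (u m : ℝ)) (hu (Nat.zero_le m))
        (hu (Nat.le_succ m))]
      gcongr
      rw [edist_comm]
      exact edist_le_pathELength_of_mem_Icc J hγ (u m).2.1 (hu (Nat.le_succ m)) (u (m + 1)).2.2
  exact (hsum m).trans (pathELength_mono (u 0).2.1 (u m).2.2)

end LengthSpace

/-! ### Arc length along a path -/

section Subpath

variable {X : Type*} [PseudoEMetricSpace X] {x y : X}

theorem pathLength_subpath (γ : Path x y) {s t : I} (h : s ≤ t) :
    pathLength (γ.subpath s t) = eVariationOn γ (Icc s t) := by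
  have hmono : Monotone (Set.Icc.convexComb s t) := by
    intro a b hab
    have h1 : (s : ℝ) ≤ t := h
    have h2 : (a : ℝ) ≤ b := hab
    show (1 - (a : ℝ)) * s + a * t ≤ (1 - (b : ℝ)) * s + b * t
    nlinarith
  unfold pathLength
  have e : ⇑(γ.subpath s t) = γ ∘ Set.Icc.convexComb s t := rfl
  rw [e, eVariationOn.comp_eq_of_monotoneOn _ _ (hmono.monotoneOn _), image_univ,
    Path.range_subpathAux, uIcc_of_le h]

/-- The arc length of a rectifiable path is a continuous function of its endpoint. -/
theorem continuous_eVariationOn_Icc_zero (γ : Path x y) (h : pathLength γ ≠ ⊤) :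
    Continuous fun t : I => eVariationOn γ (Icc 0 t) := by
  have hfin : ∀ s : Set I, eVariationOn γ s ≠ ⊤ := fun s =>
    ne_top_of_le_ne_top h (eVariationOn.mono _ (subset_univ s))
  rw [continuous_iff_continuousAt]
  intro t
  have hb : BoundedVariationOn γ univ := h
  have hl := hb.tendsto_eVariationOn_Icc_zero_left (x := t) γ.continuous.continuousWithinAt
  have hr := hb.tendsto_eVariationOn_Icc_zero_right t γ.continuous.continuousWithinAt
  simp only [univ_inter, nhdsWithin_univ] at hl hr
  have hadd : ∀ {a b : I}, a ≤ b →
      eVariationOn γ (Icc 0 a) + eVariationOn γ (Icc a b) = eVariationOn γ (Icc 0 b) := by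
    intro a b hab
    have := eVariationOn.Icc_add_Icc γ (s := univ) (a := 0) (b := a) (c := b) a.2.1 hab
      (mem_univ _)
    simpa only [univ_inter] using this
  have hlow : Tendsto (fun s => eVariationOn γ (Icc 0 t) - eVariationOn γ (Icc s t)) (𝓝 t)
      (𝓝 (eVariationOn γ (Icc 0 t))) := by
    simpa using ENNReal.Tendsto.sub (tendsto_const_nhds (x := eVariationOn γ (Icc 0 t))) hl
      (Or.inl (hfin _))
  have hup : Tendsto (fun s => eVariationOn γ (Icc 0 t) + eVariationOn γ (Icc t s)) (𝓝 t)
      (𝓝 (eVariationOn γ (Icc 0 t))) := by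
    simpa using (tendsto_const_nhds (x := eVariationOn γ (Icc 0 t))).add hr
  refine tendsto_of_tendsto_of_tendsto_of_le_of_le hlow hup (fun s => ?_) (fun s => ?_)
  · refine tsub_le_iff_right.2 ?_
    rcases le_total s t with hst | hst
    · exact (hadd hst).ge
    · exact (eVariationOn.mono _ (Icc_subset_Icc_right hst)).trans le_self_add
  · rcases le_total s t with hst | hst
    · exact (eVariationOn.mono _ (Icc_subset_Icc_right hst)).trans le_self_add
    · exact (hadd hst).ge

/-- A path of length less than `A + B` is cut, up to homotopy, into two paths of lengths less than
`A` and `B`. -/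
theorem exists_split_of_pathLength_lt (γ : Path x y) {A B : ℝ≥0∞} (hA : 0 < A) (hB : 0 < B)
    (h : pathLength γ < A + B) :
    ∃ (z : X) (α : Path x z) (β : Path z y),
      (α.trans β).Homotopic γ ∧ pathLength α < A ∧ pathLength β < B := by
  rcases lt_or_ge (pathLength γ) A with hlt | hge
  · exact ⟨y, γ, Path.refl y, ⟨Path.Homotopy.transRefl γ⟩, hlt, by rwa [pathLength_refl]⟩
  have hfin : pathLength γ ≠ ⊤ := h.ne_top
  have hsub : pathLength γ - B < A := by
    rcases le_total B (pathLength γ) with hB' | hB'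
    · exact ENNReal.sub_lt_of_lt_add hB' h
    · rwa [tsub_eq_zero_of_le hB']
  obtain ⟨c, hc1, hc2⟩ := exists_between hsub
  have hv1 : eVariationOn γ (Icc 0 1) = pathLength γ := by
    unfold pathLength
    congr 1
    exact eq_univ_of_forall fun t => ⟨t.2.1, t.2.2⟩
  obtain ⟨t, ht⟩ : c ∈ range fun t : I => eVariationOn γ (Icc 0 t) :=
    mem_range_of_exists_le_of_exists_ge (continuous_eVariationOn_Icc_zero γ hfin)
      ⟨0, by simp⟩ ⟨1, by rw [hv1]; exact hc2.le.trans hge⟩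
  refine ⟨γ t, (γ.subpath 0 t).cast γ.source.symm rfl, (γ.subpath t 1).cast rfl γ.target.symm,
    ?_, ?_, ?_⟩
  · have := Path.Homotopic.pathCast ⟨Path.Homotopy.subpathTransSubpath γ 0 t 1⟩
      γ.source.symm γ.target.symm
    rw [Path.cast_trans _ _ γ.source.symm rfl, Path.subpath_zero_one] at this
    exact this
  · exact (pathLength_subpath γ t.2.1).trans_lt (ht.trans_lt hc2)
  · refine (pathLength_subpath γ t.2.2).trans_lt ?_
    have hadd := eVariationOn.Icc_add_Icc γ (s := univ) (a := 0) (b := t) (c := 1) t.2.1 t.2.2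
      (mem_univ _)
    simp only [univ_inter, hv1] at hadd
    have ht' : eVariationOn γ (Icc 0 t) = c := ht
    rw [ht'] at hadd
    by_contra! hB'
    have hBtop : B ≠ ⊤ :=
      ne_top_of_le_ne_top hfin (hB'.trans (eVariationOn.mono _ (subset_univ _)))
    have h1 : pathLength γ < c + B := by
      calc pathLength γ ≤ pathLength γ - B + B := le_tsub_add
        _ < c + B := by
          exact (ENNReal.add_lt_add_iff_right hBtop).2 hc1
    have h2 : c + B ≤ pathLength γ := by
      rw [← hadd]
      gcongr
    exact absurd (h1.trans_le h2) (lt_irrefl _)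

end Subpath

/-! ### Uniform control of small balls -/

/-- In a manifold, two paths with the same endpoints that stay close to a point are homotopic. -/
theorem exists_nhds_path_homotopic (n : ℕ) {M : Type*} [TopologicalSpace M]
    [ChartedSpace (EuclideanSpace ℝ (Fin n)) M] (y : M) :
    ∃ U ∈ 𝓝 y, ∀ ⦃a b : M⦄ (γ δ : Path a b), (∀ t, γ t ∈ U) → (∀ t, δ t ∈ U) →
      γ.Homotopic δ := by
  set e := chartAt (EuclideanSpace ℝ (Fin n)) y with he
  have hy : y ∈ e.source := mem_chart_source _ y
  obtain ⟨ε, hε, hball⟩ := Metric.isOpen_iff.1 e.open_target (e y) (e.map_source hy)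
  refine ⟨e.source ∩ e ⁻¹' Metric.ball (e y) ε,
    (e.isOpen_inter_preimage Metric.isOpen_ball).mem_nhds ⟨hy, Metric.mem_ball_self hε⟩, ?_⟩
  intro a b γ δ hγ hδ
  have hγc : Continuous fun t => e (γ t) :=
    e.continuousOn.comp_continuous γ.continuous fun t => (hγ t).1
  have hδc : Continuous fun t => e (δ t) :=
    e.continuousOn.comp_continuous δ.continuous fun t => (hδ t).1
  have hmem : ∀ p : I × I,
      AffineMap.lineMap (e (γ p.2)) (e (δ p.2)) (p.1 : ℝ) ∈ Metric.ball (e y) ε := fun p =>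
    (convex_ball (e y) ε).lineMap_mem (hγ p.2).2 (hδ p.2).2 p.1.2
  refine ⟨⟨⟨⟨fun p => e.symm (AffineMap.lineMap (e (γ p.2)) (e (δ p.2)) (p.1 : ℝ)), ?_⟩,
    ?_, ?_⟩, ?_⟩⟩
  · refine e.continuousOn_symm.comp_continuous ?_ fun p => hball (hmem p)
    simp only [AffineMap.lineMap_apply_module]
    have h1 : Continuous fun p : I × I => e (γ p.2) := hγc.comp continuous_snd
    have h2 : Continuous fun p : I × I => e (δ p.2) := hδc.comp continuous_snd
    have h3 : Continuous fun p : I × I => (p.1 : ℝ) := by fun_prop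
    exact ((continuous_const.sub h3).smul h1).add (h3.smul h2)
  · intro t
    simp [e.left_inv (hγ t).1]
  · intro t
    simp [e.left_inv (hδ t).1]
  · intro s t ht
    have h : δ t = γ t := by
      rcases ht with rfl | ht
      · simp
      · rw [mem_singleton_iff.1 ht]; simp
    simp [h, e.left_inv (hγ t).1]

/-- Any two points of a length space are joined by paths whose length is arbitrarily close to their
distance. -/
def IsLengthSpace (X : Type*) [PseudoEMetricSpace X] : Prop :=
  ∀ ⦃x y : X⦄ ⦃r : ℝ≥0∞⦄, edist x y < r → ∃ γ : Path x y, pathLength γ < r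

/-- Every ball of radius `δ` in `M` is, uniformly, as simple as in Euclidean space: two paths in it
with the same endpoints are homotopic in `M`, and there is an open bi-Lipschitz map from it to
`n`-dimensional Euclidean space. -/
structure IsUniformScale (n : ℕ) (M : Type*) [EMetricSpace M] (δ : ℝ≥0∞) : Prop where
  pos : 0 < δ
  ne_top : δ ≠ ⊤
  homotopic : ∀ (y : M) ⦃a b : M⦄ (γ γ' : Path a b), (∀ t, γ t ∈ Metric.eball y δ) →
    (∀ t, γ' t ∈ Metric.eball y δ) → γ.Homotopic γ'
  exists_chart : ∀ y : M, ∃ (φ : M → EuclideanSpace ℝ (Fin n)) (K : NNReal),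
    (∀ V ⊆ Metric.eball y δ, IsOpen V → IsOpen (φ '' V)) ∧
    ∀ a ∈ Metric.eball y δ, ∀ b ∈ Metric.eball y δ,
      edist (φ a) (φ b) ≤ K * edist a b ∧ edist a b ≤ K * edist (φ a) (φ b)

section Riemannian

variable {n : ℕ} {M : Type*} [EMetricSpace M]
    [ChartedSpace (EuclideanSpace ℝ (Fin n)) M] [IsManifold (𝓡 n) 1 M]
    [RiemannianBundle (fun x : M => TangentSpace (𝓡 n) x)]
    [IsContinuousRiemannianBundle (EuclideanSpace ℝ (Fin n))
      (fun x : M => TangentSpace (𝓡 n) x)]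
    [IsRiemannianManifold (𝓡 n) M]

variable (n M) in
/-- A compact Riemannian manifold has a uniform scale, by the Lebesgue number lemma. -/
theorem exists_isUniformScale [CompactSpace M] : ∃ δ : ℝ≥0∞, IsUniformScale n M δ := by
  have key : ∀ x : M, ∃ U : Set M, IsOpen U ∧ x ∈ U ∧
      (∀ ⦃a b : M⦄ (γ γ' : Path a b), (∀ t, γ t ∈ U) → (∀ t, γ' t ∈ U) → γ.Homotopic γ') ∧
      ∃ (φ : M → EuclideanSpace ℝ (Fin n)) (K : NNReal),
        (∀ V ⊆ U, IsOpen V → IsOpen (φ '' V)) ∧ ∀ a ∈ U, ∀ b ∈ U,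
          edist (φ a) (φ b) ≤ K * edist a b ∧ edist a b ≤ K * edist (φ a) (φ b) := by
    intro x
    obtain ⟨U₁, hU₁, h₁⟩ := exists_nhds_path_homotopic n x
    obtain ⟨C₂, U₂, hU₂, h₂⟩ := exists_nhds_edist_extChartAt_le (𝓡 n) x
    obtain ⟨C₃, U₃, hU₃, h₃⟩ := exists_nhds_riemannianEDist_le_edist_extChartAt (𝓡 n) x
    obtain ⟨U, hU, hUo, hxU⟩ := mem_nhds_iff.1 (inter_mem (inter_mem hU₁ hU₂)
      (inter_mem hU₃ (chart_source_mem_nhds (EuclideanSpace ℝ (Fin n)) x)))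
    refine ⟨U, hUo, hxU, fun a b γ γ' hγ hγ' => h₁ γ γ' (fun t => (hU (hγ t)).1.1)
      (fun t => (hU (hγ' t)).1.1), extChartAt (𝓡 n) x, max C₂ C₃, ?_, ?_⟩
    · intro V hV hVo
      have := (chartAt (EuclideanSpace ℝ (Fin n)) x).isOpen_image_of_subset_source hVo
        fun v hv => (hU (hV hv)).2.2
      simpa using this
    · intro a ha b hb
      refine ⟨(h₂ a (hU ha).1.2 b (hU hb).1.2).trans ?_, ?_⟩
      · gcongr
        exact le_max_left _ _
      · rw [(IsRiemannianManifold.out a b : _ = riemannianEDist (𝓡 n) a b)]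
        refine (h₃ a (hU ha).2.1 b (hU hb).2.1).trans ?_
        gcongr
        exact le_max_right _ _
  choose U hUo hxU hhom hchart using key
  obtain ⟨δ, hδ, hδU⟩ := lebesgue_number_lemma_of_emetric (isCompact_univ (X := M)) hUo
    (fun x _ => mem_iUnion.2 ⟨x, hxU x⟩)
  have hsub : ∀ y : M, ∃ x, Metric.eball y (min δ 1) ⊆ U x := fun y => by
    obtain ⟨x, hx⟩ := hδU y (mem_univ y)
    exact ⟨x, (Metric.eball_subset_eball (min_le_left _ _)).trans hx⟩
  refine ⟨min δ 1, lt_min hδ one_pos, ne_top_of_le_ne_top ENNReal.one_ne_top (min_le_right _ _),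
    fun y a b γ γ' hγ hγ' => ?_, fun y => ?_⟩
  · obtain ⟨x, hx⟩ := hsub y
    exact hhom x γ γ' (fun t => hx (hγ t)) (fun t => hx (hγ' t))
  · obtain ⟨x, hx⟩ := hsub y
    obtain ⟨φ, K, h1, h2⟩ := hchart x
    exact ⟨φ, K, fun V hV => h1 V (hV.trans hx), fun a ha b hb => h2 a (hx ha) b (hx hb)⟩

end Riemannian

theorem isLengthSpace_of_isRiemannianManifold (n : ℕ) (M : Type*) [EMetricSpace M]
    [ChartedSpace (EuclideanSpace ℝ (Fin n)) M]
    [RiemannianBundle (fun x : M => TangentSpace (𝓡 n) x)] [IsRiemannianManifold (𝓡 n) M] :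
    IsLengthSpace M :=
  fun _ _ _ h => exists_path_pathLength_lt (𝓡 n) h

/-! ### Metric geometry of the universal cover -/

namespace UniversalCover

variable {n : ℕ} {M : Type*} [EMetricSpace M] [ChartedSpace (EuclideanSpace ℝ (Fin n)) M] {x : M}

theorem edist_le_pathLength {a b : UniversalCover n x} (γ : Path a.proj b.proj)
    (h : a.cls.trans (.mk γ) = b.cls) : edist a b ≤ pathLength γ :=
  iInf₂_le γ h

theorem exists_path_of_edist_lt {a b : UniversalCover n x} {r : ℝ≥0∞} (h : edist a b < r) :
    ∃ γ : Path a.proj b.proj, a.cls.trans (.mk γ) = b.cls ∧ pathLength γ < r := by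
  change coverEDist a b < r at h
  simpa only [coverEDist, iInf_lt_iff, exists_prop] using h

theorem edist_proj_le (a b : UniversalCover n x) : edist a.proj b.proj ≤ edist a b := by
  refine le_iInf₂ fun γ _ => ?_
  have := _root_.edist_le_pathLength γ 1
  rwa [γ.target, edist_comm] at this

/-- The universal cover is a length space, in the form that any point at distance less than `A + B`
can be reached in two steps of lengths less than `A` and `B`. -/
theorem exists_edist_lt_edist_lt {a b : UniversalCover n x} {A B : ℝ≥0∞} (hA : 0 < A) (hB : 0 < B)
    (h : edist a b < A + B) : ∃ c : UniversalCover n x, edist a c < A ∧ edist c b < B := by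
  obtain ⟨γ, hγ, hlt⟩ := exists_path_of_edist_lt h
  obtain ⟨z, α, β, hαβ, hα, hβ⟩ := exists_split_of_pathLength_lt γ hA hB hlt
  refine ⟨⟨z, a.cls.trans (.mk α)⟩, (edist_le_pathLength α rfl).trans_lt hα,
    (edist_le_pathLength β ?_).trans_lt hβ⟩
  rw [Path.Homotopic.Quotient.trans_assoc, ← Path.Homotopic.Quotient.mk_trans, ← hγ]
  congr 1
  exact Path.Homotopic.Quotient.eq.2 hαβ

theorem image_proj_eball (hL : IsLengthSpace M) (a : UniversalCover n x) (r : ℝ≥0∞) :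
    proj '' Metric.eball a r = Metric.eball a.proj r := by
  ext z
  constructor
  · rintro ⟨b, hb, rfl⟩
    exact (edist_proj_le b a).trans_lt hb
  · intro hz
    obtain ⟨γ, hγ⟩ := hL (Metric.mem_eball'.1 hz)
    exact ⟨⟨z, a.cls.trans (.mk γ)⟩, Metric.mem_eball'.2 ((edist_le_pathLength γ rfl).trans_lt hγ),
      rfl⟩

/-- The covering projection is isometric on balls whose radius is small at a uniform scale: short
paths between the projections of two points of such a ball are homotopic, so each of them lifts to a
path between the two points. -/
theorem edist_eq_edist_proj (hL : IsLengthSpace M) {δ r : ℝ≥0∞} (hδ : IsUniformScale n M δ)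
    (hr : 3 * r ≤ δ) {a b c : UniversalCover n x} (hb : b ∈ Metric.eball a r)
    (hc : c ∈ Metric.eball a r) : edist b c = edist b.proj c.proj := by
  refine le_antisymm ?_ (edist_proj_le b c)
  have hbc : edist b c < r + r :=
    (edist_triangle_right b c a).trans_lt (ENNReal.add_lt_add hb hc)
  obtain ⟨γ, hγ, hγr⟩ := exists_path_of_edist_lt hbc
  have hmem : ∀ β : Path b.proj c.proj, pathLength β < r + r →
      ∀ t, β t ∈ Metric.eball a.proj δ := by
    intro β hβ t
    calc edist (β t) a.proj ≤ edist (β t) b.proj + edist b.proj a.proj := edist_triangle _ _ _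
      _ < r + r + r := ENNReal.add_lt_add ((_root_.edist_le_pathLength β t).trans_lt hβ)
          ((edist_proj_le b a).trans_lt hb)
      _ = 3 * r := by ring
      _ ≤ δ := hr
  refine le_of_forall_gt fun s hs => ?_
  obtain ⟨β, hβ⟩ := hL (lt_min hs ((edist_proj_le b c).trans_lt hbc))
  refine (edist_le_pathLength β ?_).trans_lt (hβ.trans_le (min_le_left _ _))
  rw [← hγ]
  congr 1
  exact Path.Homotopic.Quotient.eq.2 (hδ.homotopic a.proj β γ
    (hmem β (hβ.trans_le (min_le_right _ _))) (hmem γ hγr))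

/-- Prolonging paths backwards along a class `g` of paths from `x` to `x'` is an isometry between
the universal covers with base points `x'` and `x`; for `x' = x` these are the deck
transformations. -/
noncomputable def translate {x' : M} (g : Path.Homotopic.Quotient x x') :
    UniversalCover n x' ≃ᵢ UniversalCover n x where
  toFun a := ⟨a.proj, g.trans a.cls⟩
  invFun a := ⟨a.proj, g.symm.trans a.cls⟩
  left_inv a := by
    dsimp only
    rw [← Path.Homotopic.Quotient.trans_assoc, Path.Homotopic.Quotient.symm_trans,
      Path.Homotopic.Quotient.refl_trans]
  right_inv a := by
    dsimp only
    rw [← Path.Homotopic.Quotient.trans_assoc, Path.Homotopic.Quotient.trans_symm,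
      Path.Homotopic.Quotient.refl_trans]
  isometry_toFun a b := by
    change coverEDist _ _ = coverEDist _ _
    unfold coverEDist
    have : ∀ γ : Path a.proj b.proj, (g.trans a.cls).trans (.mk γ) = g.trans b.cls ↔
        a.cls.trans (.mk γ) = b.cls := by
      intro γ
      rw [Path.Homotopic.Quotient.trans_assoc]
      refine ⟨fun h => ?_, fun h => by rw [h]⟩
      have := congrArg g.symm.trans h
      rwa [← Path.Homotopic.Quotient.trans_assoc, ← Path.Homotopic.Quotient.trans_assoc g.symm g,
        Path.Homotopic.Quotient.symm_trans, Path.Homotopic.Quotient.refl_trans,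
        Path.Homotopic.Quotient.refl_trans] at this
    simp only [this]

theorem translate_apply {x' : M} (g : Path.Homotopic.Quotient x x') (a : UniversalCover n x') :
    translate g a = ⟨a.proj, g.trans a.cls⟩ := rfl

/-- The lift of the base point to the universal cover. -/
def base (x : M) : UniversalCover n x := ⟨x, .refl x⟩

theorem totallyBounded_eball_of_le [CompactSpace M] (hL : IsLengthSpace M) {δ r : ℝ≥0∞}
    (hδ : IsUniformScale n M δ) (hr : 3 * r ≤ δ) (a : UniversalCover n x) :
    TotallyBounded (Metric.eball a r) := by
  have hiso : Isometry fun b : Metric.eball a r => (b : UniversalCover n x).proj := fun b c =>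
    (edist_eq_edist_proj hL hδ hr b.2 c.2).symm
  have h := totallyBounded_preimage hiso.isUniformInducing (isCompact_univ (X := M)).totallyBounded
  have h' := h.image (uniformContinuous_subtype_val (p := (· ∈ Metric.eball a r)))
  rwa [preimage_univ, image_univ, Subtype.range_coe] at h'

/-- Balls of finite radius in the universal cover are totally bounded: with `ρ` a fixed fraction of
the uniform scale, a finite `ρ`-net of the ball of radius `m * ρ` is a finite `3 * ρ`-net of the
ball of radius `(m + 1) * ρ`, and balls of radius `3 * ρ` are totally bounded. -/
theorem totallyBounded_eball [CompactSpace M] (hL : IsLengthSpace M) {δ : ℝ≥0∞}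
    (hδ : IsUniformScale n M δ) (a : UniversalCover n x) {R : ℝ≥0∞} (hR : R ≠ ⊤) :
    TotallyBounded (Metric.eball a R) := by
  set ρ := δ / 9 with hρ
  have hρ0 : 0 < ρ := ENNReal.div_pos hδ.pos.ne' (by simp)
  have h9 : 3 * (3 * ρ) = δ := by
    rw [← mul_assoc, hρ, show (3 : ℝ≥0∞) * 3 = 9 by norm_num]
    exact ENNReal.mul_div_cancel (by simp) (by simp)
  have key : ∀ m : ℕ, TotallyBounded (Metric.eball a (m * ρ)) := by
    intro m
    induction m with
    | zero => simp
    | succ m ih =>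
      rcases Nat.eq_zero_or_pos m with rfl | hm
      · refine (totallyBounded_eball_of_le hL hδ h9.le a).subset (Metric.eball_subset_eball ?_)
        gcongr
        norm_num
      obtain ⟨t, ht, hcov⟩ := EMetric.totallyBounded_iff.1 ih ρ hρ0
      refine TotallyBounded.subset ?_ ((totallyBounded_biUnion ht).2
        fun b _ => totallyBounded_eball_of_le hL hδ h9.le b)
      intro z hz
      have hmρ : 0 < (m : ℝ≥0∞) * ρ := ENNReal.mul_pos (by exact_mod_cast hm.ne') hρ0.ne'
      obtain ⟨w, haw, hwz⟩ := exists_edist_lt_edist_lt hmρ (B := ρ + ρ) (by positivity)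
        ((Metric.mem_eball'.1 hz).trans_le (by
          push_cast
          rw [add_mul, one_mul, ← add_assoc]
          exact le_self_add))
      obtain ⟨b, hb, hwb⟩ := mem_iUnion₂.1 (hcov (Metric.mem_eball'.2 haw))
      refine mem_iUnion₂.2 ⟨b, hb, ?_⟩
      calc edist z b ≤ edist w z + edist w b := edist_triangle_left _ _ _
        _ < ρ + ρ + ρ := ENNReal.add_lt_add hwz hwb
        _ = 3 * ρ := by ring
  obtain ⟨m, hm⟩ := ENNReal.exists_nat_mul_gt hρ0.ne' hR
  exact (key m).subset (Metric.eball_subset_eball hm.le)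

end UniversalCover

/-! ### Volume of balls in the universal cover -/

theorem LipschitzOnWith.euclideanHausdorffMeasure_image_le {X Y : Type*} [EMetricSpace X]
    [EMetricSpace Y] [MeasurableSpace X] [BorelSpace X] [MeasurableSpace Y] [BorelSpace Y]
    {K : NNReal} {f : X → Y} {s : Set X} (h : LipschitzOnWith K f s) (d : ℕ) :
    (μHE[d] : Measure Y) (f '' s) ≤ (K : ℝ≥0∞) ^ d * (μHE[d] : Measure X) s := by
  simp only [Measure.euclideanHausdorffMeasure_def, Measure.smul_apply]
  have := h.hausdorffMeasure_image_le (Nat.cast_nonneg (α := ℝ) d)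
  rw [ENNReal.rpow_natCast] at this
  rw [ENNReal.smul_def, ENNReal.smul_def, smul_eq_mul, smul_eq_mul, mul_left_comm]
  gcongr

namespace UniversalCover

variable {n : ℕ} {M : Type*} [EMetricSpace M] [ChartedSpace (EuclideanSpace ℝ (Fin n)) M] {x : M}

theorem vol_eball_pos (hL : IsLengthSpace M) {δ r : ℝ≥0∞} (hδ : IsUniformScale n M δ)
    (hr0 : 0 < r) (a : UniversalCover n x) : 0 < vol (Metric.eball a r) := by
  obtain ⟨φ, K, hopen, hlip⟩ := hδ.exists_chart a.proj
  set s := min r δ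
  have hs0 : 0 < s := lt_min hr0 hδ.pos
  have hmem : ∀ b ∈ Metric.eball a s, b.proj ∈ Metric.eball a.proj δ := fun b hb =>
    ((edist_proj_le b a).trans_lt hb).trans_le (min_le_right _ _)
  have hφ : LipschitzOnWith K (φ ∘ proj) (Metric.eball a s) := fun b hb c hc =>
    (hlip _ (hmem b hb) _ (hmem c hc)).1.trans (by gcongr; exact edist_proj_le b c)
  have hle := hφ.euclideanHausdorffMeasure_image_le n
  rw [EuclideanSpace.euclideanHausdorffMeasure_eq_volume, image_comp, image_proj_eball hL] at hle
  have hpos : 0 < (volume : Measure (EuclideanSpace ℝ (Fin n))) (φ '' Metric.eball a.proj s) :=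
    (hopen _ (Metric.eball_subset_eball (min_le_right _ _)) Metric.isOpen_eball).measure_pos _
      ⟨_, mem_image_of_mem _ (Metric.mem_eball_self hs0)⟩
  have : 0 < vol (Metric.eball a s) :=
    pos_iff_ne_zero.2 fun h0 => (hpos.trans_le hle).ne' (by
      rw [show (μHE[n] : Measure (UniversalCover n x)) (Metric.eball a s) = 0 from h0, mul_zero])
  exact this.trans_le (measure_mono (Metric.eball_subset_eball (min_le_left _ _)))

theorem vol_eball_lt_top_of_le (hL : IsLengthSpace M) {δ r : ℝ≥0∞} (hδ : IsUniformScale n M δ)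
    (hr : 3 * r ≤ δ) (a : UniversalCover n x) : vol (Metric.eball a r) < ⊤ := by
  obtain ⟨φ, K, -, hlip⟩ := hδ.exists_chart a.proj
  have hrδ : r ≤ δ := le_trans (by
    calc r = 1 * r := (one_mul r).symm
      _ ≤ 3 * r := by gcongr; norm_num) hr
  have hmem : ∀ b ∈ Metric.eball a r, b.proj ∈ Metric.eball a.proj δ := fun b hb =>
    ((edist_proj_le b a).trans_lt hb).trans_le hrδ
  set f : UniversalCover n x → EuclideanSpace ℝ (Fin n) := φ ∘ proj with hf
  have hanti : ∀ b ∈ Metric.eball a r, ∀ c ∈ Metric.eball a r,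
      edist b c ≤ K * edist (f b) (f c) := fun b hb c hc => by
    rw [edist_eq_edist_proj hL hδ hr hb hc]
    exact (hlip _ (hmem b hb) _ (hmem c hc)).2
  have hinj : InjOn f (Metric.eball a r) := fun b hb c hc h => by
    have := hanti b hb c hc
    rw [h, edist_self, mul_zero] at this
    exact edist_eq_zero.1 (le_antisymm this bot_le)
  have : Nonempty (UniversalCover n x) := ⟨a⟩
  set g := Function.invFunOn f (Metric.eball a r)
  have hgf : LeftInvOn g f (Metric.eball a r) := hinj.leftInvOn_invFunOn
  have hg : LipschitzOnWith K g (f '' Metric.eball a r) := by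
    rintro _ ⟨b, hb, rfl⟩ _ ⟨c, hc, rfl⟩
    rw [hgf hb, hgf hc]
    exact hanti b hb c hc
  have hle := hg.euclideanHausdorffMeasure_image_le n
  rw [hgf.image_image, EuclideanSpace.euclideanHausdorffMeasure_eq_volume] at hle
  refine hle.trans_lt (ENNReal.mul_lt_top (by simp) ?_)
  have hsub : f '' Metric.eball a r ⊆ Metric.closedBall (f a) (K * δ).toReal := by
    rintro _ ⟨b, hb, rfl⟩
    have htop : (K : ℝ≥0∞) * δ ≠ ⊤ := ENNReal.mul_ne_top (by simp) hδ.ne_top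
    rw [Metric.mem_closedBall, dist_edist]
    refine ENNReal.toReal_mono htop
      ((hlip _ (hmem b hb) a.proj (Metric.mem_eball_self hδ.pos)).1.trans ?_)
    gcongr
    exact (Metric.mem_eball.1 (hmem b hb)).le
  exact (measure_mono hsub).trans_lt measure_closedBall_lt_top

theorem vol_eball_lt_top [CompactSpace M] (hL : IsLengthSpace M) {δ : ℝ≥0∞}
    (hδ : IsUniformScale n M δ) (a : UniversalCover n x) {R : ℝ≥0∞} (hR : R ≠ ⊤) :
    vol (Metric.eball a R) < ⊤ := by
  have h3 : 0 < δ / 3 := ENNReal.div_pos hδ.pos.ne' (by simp)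
  obtain ⟨t, ht, hcov⟩ := EMetric.totallyBounded_iff.1 (totallyBounded_eball hL hδ a hR) _ h3
  refine (measure_mono hcov).trans_lt (measure_biUnion_lt_top ht fun b _ => ?_)
  exact vol_eball_lt_top_of_le hL hδ (ENNReal.mul_div_cancel (by simp) (by simp)).le b

theorem vol_eball_translate {x' : M} (g : Path.Homotopic.Quotient x x') (a : UniversalCover n x')
    (r : ℝ≥0∞) : vol (Metric.eball (translate g a) r) = vol (Metric.eball a r) := by
  rw [← IsometryEquiv.image_eball]
  exact (translate g).isometry.euclideanHausdorffMeasure_image _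

end UniversalCover

/-! ### Counting points of the orbit of the fundamental group -/

/-- A compact connected extended metric space has finite diameter. -/
theorem exists_forall_edist_lt_ofReal (X : Type*) [EMetricSpace X] [CompactSpace X]
    [ConnectedSpace X] : ∃ D : ℝ, 0 < D ∧ ∀ y z : X, edist y z < ENNReal.ofReal D := by
  obtain ⟨x⟩ : Nonempty X := inferInstance
  have hclopen : IsClopen (Metric.eball x ⊤) := by
    refine ⟨⟨isOpen_iff_mem_nhds.2 fun y hy => ?_⟩, Metric.isOpen_eball⟩
    refine mem_of_superset (Metric.eball_mem_nhds y one_pos) fun z hz hzx => hy ?_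
    exact (edist_triangle_left y x z).trans_lt
      (ENNReal.add_lt_top.2 ⟨lt_top_iff_ne_top.2 (ne_top_of_lt (Metric.mem_eball.1 hz)), hzx⟩)
  have huniv := hclopen.eq_univ ⟨x, Metric.mem_eball_self ENNReal.zero_lt_top⟩
  obtain ⟨w, -, hw⟩ := (isCompact_univ (X := X)).exists_isMaxOn univ_nonempty
    (f := fun y => edist y x) (by fun_prop)
  have hwfin : edist w x ≠ ⊤ := ne_top_of_lt (Metric.mem_eball.1 (huniv ▸ mem_univ w))
  refine ⟨(edist w x + edist w x).toReal + 1, by positivity, fun y z => ?_⟩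
  have h2 : edist w x + edist w x ≠ ⊤ := ENNReal.add_ne_top.2 ⟨hwfin, hwfin⟩
  rw [ENNReal.lt_ofReal_iff_toReal_lt]
  · refine lt_of_le_of_lt (ENNReal.toReal_mono h2 ?_) (lt_add_one _)
    exact (edist_triangle_right y z x).trans (add_le_add (hw (mem_univ y)) (hw (mem_univ z)))
  · exact ne_top_of_le_ne_top h2
      ((edist_triangle_right y z x).trans (add_le_add (hw (mem_univ y)) (hw (mem_univ z))))

namespace UniversalCover

variable {n : ℕ} {M : Type*} [EMetricSpace M] [ChartedSpace (EuclideanSpace ℝ (Fin n)) M] {x : M}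

variable (n) in
/-- The distance by which a loop class moves the lift of the base point; equivalently, the infimum
of the lengths of the loops in the class. -/
noncomputable def displacement (g : Path.Homotopic.Quotient x x) : ℝ≥0∞ :=
  edist (base x : UniversalCover n x) ⟨x, g⟩

theorem displacement_mk_le (γ : Path x x) :
    displacement n (Path.Homotopic.Quotient.mk γ) ≤ pathLength γ :=
  edist_le_pathLength (a := (base x : UniversalCover n x)) (b := ⟨x, .mk γ⟩) γ
    (Path.Homotopic.Quotient.refl_trans (Path.Homotopic.Quotient.mk γ))

theorem displacement_refl : displacement n (Path.Homotopic.Quotient.refl x) = 0 :=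
  edist_self _

theorem translate_base (g : Path.Homotopic.Quotient x x) :
    translate g (base x : UniversalCover n x) = ⟨x, g⟩ :=
  congrArg (UniversalCover.mk x) (Path.Homotopic.Quotient.trans_refl g)

theorem edist_mk_mk (g h : Path.Homotopic.Quotient x x) :
    edist (⟨x, g⟩ : UniversalCover n x) ⟨x, h⟩ = displacement n (g.symm.trans h) := by
  have := (translate g).isometry.edist_eq (base x : UniversalCover n x) ⟨x, g.symm.trans h⟩
  rwa [translate_base, translate_apply, ← Path.Homotopic.Quotient.trans_assoc,
    Path.Homotopic.Quotient.trans_symm, Path.Homotopic.Quotient.refl_trans] at this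

theorem displacement_symm (g : Path.Homotopic.Quotient x x) :
    displacement n g.symm = displacement n g := by
  have := edist_mk_mk (n := n) g (Path.Homotopic.Quotient.refl x)
  rw [Path.Homotopic.Quotient.trans_refl] at this
  rw [← this, edist_comm]
  rfl

theorem displacement_trans_le (g h : Path.Homotopic.Quotient x x) :
    displacement n (g.trans h) ≤ displacement n g + displacement n h := by
  have := edist_mk_mk (n := n) g (g.trans h)
  rw [← Path.Homotopic.Quotient.trans_assoc, Path.Homotopic.Quotient.symm_trans,
    Path.Homotopic.Quotient.refl_trans] at this
  rw [← this]
  exact edist_triangle _ _ _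

theorem vol_eball_mk (g : Path.Homotopic.Quotient x x) (r : ℝ≥0∞) :
    vol (Metric.eball (⟨x, g⟩ : UniversalCover n x) r) =
      vol (Metric.eball (base x : UniversalCover n x) r) := by
  rw [← translate_base g, vol_eball_translate]

/-- The orbit of the lifted base point is dense up to the diameter of the manifold. -/
theorem exists_edist_mk_lt (hL : IsLengthSpace M) {D : ℝ≥0∞} (hD : ∀ y z : M, edist y z < D)
    (c : UniversalCover n x) :
    ∃ g : Path.Homotopic.Quotient x x, edist c ⟨x, g⟩ < D := by
  obtain ⟨γ, hγ⟩ := hL (hD c.proj x)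
  exact ⟨c.cls.trans (.mk γ), (edist_le_pathLength γ rfl).trans_lt hγ⟩

variable (n x) in
/-- The loop classes that move the lifted base point by less than `R`. -/
def shortClasses (R : ℝ) : Set (Path.Homotopic.Quotient x x) :=
  {g | displacement n g < ENNReal.ofReal R}

theorem shortClasses_mono {R S : ℝ} (h : R ≤ S) : shortClasses n x R ⊆ shortClasses n x S :=
  fun _ hg => lt_of_lt_of_le hg (ENNReal.ofReal_le_ofReal h)

/-- Two points of the orbit of the lifted base point have the same projection, so they cannot both
lie in a ball on which the projection is isometric. -/
theorem pairwise_disjoint_eball_mk (hL : IsLengthSpace M) {δ r : ℝ≥0∞}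
    (hδ : IsUniformScale n M δ) (hr : 3 * r ≤ δ) :
    Pairwise (Function.onFun Disjoint fun g : Path.Homotopic.Quotient x x =>
      Metric.eball (⟨x, g⟩ : UniversalCover n x) r) := by
  intro g h hgh
  refine Set.disjoint_left.2 fun b hg hh => hgh ?_
  have := edist_eq_edist_proj hL hδ hr (Metric.mem_eball_comm.1 hg) (Metric.mem_eball_comm.1 hh)
  rw [edist_self] at this
  have := eq_of_edist_eq_zero this
  injection this

theorem iUnion_eball_mk_subset (R r : ℝ) (hR : 0 ≤ R) (hr : 0 ≤ r) :
    ⋃ g ∈ shortClasses n x R, Metric.eball (⟨x, g⟩ : UniversalCover n x) (ENNReal.ofReal r) ⊆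
      Metric.eball (base x) (ENNReal.ofReal (R + r)) := by
  refine iUnion₂_subset fun g hg b hb => ?_
  rw [Metric.mem_eball, ENNReal.ofReal_add hR hr, add_comm]
  have hg' : edist (base x : UniversalCover n x) ⟨x, g⟩ < ENNReal.ofReal R := hg
  rw [edist_comm] at hg'
  exact (edist_triangle _ _ _).trans_lt (ENNReal.add_lt_add hb hg')

theorem finite_shortClasses [CompactSpace M] (hL : IsLengthSpace M) {δ : ℝ≥0∞}
    (hδ : IsUniformScale n M δ) (R : ℝ) : (shortClasses n x R).Finite := by
  rcases lt_or_ge R 0 with hR | hR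
  · have hempty : shortClasses n x R = ∅ := by
      refine eq_empty_of_forall_notMem fun g hg => ?_
      simp [shortClasses, ENNReal.ofReal_of_nonpos hR.le] at hg
    rw [hempty]
    exact Set.finite_empty
  set r := (δ / 3).toReal with hr
  have h3top : δ / 3 ≠ ⊤ := ENNReal.div_ne_top hδ.ne_top (by simp)
  have hr' : ENNReal.ofReal r = δ / 3 := ENNReal.ofReal_toReal h3top
  have h3 : 3 * ENNReal.ofReal r ≤ δ := by
    rw [hr']
    exact (ENNReal.mul_div_cancel (by simp) (by simp)).le
  have hpos : 0 < ENNReal.ofReal r := by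
    rw [hr']
    exact ENNReal.div_pos hδ.pos.ne' (by simp)
  set B : shortClasses n x R → Set (UniversalCover n x) := fun g =>
    Metric.eball ⟨x, g.1⟩ (ENNReal.ofReal r) with hB
  have hsub : ⋃ g, B g ⊆ Metric.eball (base x) (ENNReal.ofReal (R + r)) :=
    iUnion_subset fun g b hb => iUnion_eball_mk_subset R r hR ENNReal.toReal_nonneg
      (mem_iUnion₂.2 ⟨g.1, g.2, hb⟩)
  have htop : vol (⋃ g, B g) ≠ ⊤ :=
    ne_top_of_le_ne_top (vol_eball_lt_top hL hδ (base x) ENNReal.ofReal_ne_top).ne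
      (measure_mono hsub)
  have hdisj : Pairwise (Function.onFun Disjoint B) := fun g h hgh =>
    pairwise_disjoint_eball_mk hL hδ h3 (fun e => hgh (Subtype.ext e))
  have hfin := Measure.finite_const_le_meas_of_disjoint_iUnion (vol (n := n) (x := x))
    (vol_eball_pos hL hδ hpos (base x)) (fun g => Metric.isOpen_eball.measurableSet) hdisj htop
  have huniv : (univ : Set (shortClasses n x R)).Finite :=
    hfin.subset fun g _ => (vol_eball_mk g.1 _).ge
  have : Finite (shortClasses n x R) := Set.finite_univ_iff.1 huniv
  exact Set.toFinite _

theorem ncard_shortClasses_mul_vol_le [CompactSpace M] (hL : IsLengthSpace M) {δ : ℝ≥0∞}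
    (hδ : IsUniformScale n M δ) {R r : ℝ} (hR : 0 ≤ R) (hr : 0 ≤ r)
    (h3 : 3 * ENNReal.ofReal r ≤ δ) :
    (shortClasses n x R).ncard * vol (Metric.eball (base x : UniversalCover n x)
      (ENNReal.ofReal r)) ≤
      vol (Metric.eball (base x : UniversalCover n x) (ENNReal.ofReal (R + r))) := by
  have hfin := finite_shortClasses (x := x) hL hδ R
  refine le_trans (le_of_eq ?_) (measure_mono (iUnion_eball_mk_subset R r hR hr))
  have : ⋃ g ∈ shortClasses n x R, Metric.eball (⟨x, g⟩ : UniversalCover n x) (ENNReal.ofReal r) =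
      ⋃ g ∈ hfin.toFinset, Metric.eball (⟨x, g⟩ : UniversalCover n x) (ENNReal.ofReal r) := by
    simp
  rw [this, measure_biUnion_finset
    (fun g _ h _ hgh => pairwise_disjoint_eball_mk hL hδ h3 hgh)
    (fun g _ => Metric.isOpen_eball.measurableSet), Finset.sum_congr rfl
    (fun g _ => vol_eball_mk g _), Finset.sum_const, nsmul_eq_mul,
    Set.ncard_eq_toFinset_card _ hfin]

theorem vol_eball_le_ncard_shortClasses_mul [CompactSpace M] (hL : IsLengthSpace M) {δ : ℝ≥0∞}
    (hδ : IsUniformScale n M δ) {D : ℝ} (hD0 : 0 < D)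
    (hD : ∀ y z : M, edist y z < ENNReal.ofReal D) {R : ℝ} (hR : 0 ≤ R) :
    vol (Metric.eball (base x : UniversalCover n x) (ENNReal.ofReal R)) ≤
      (shortClasses n x (R + D)).ncard *
        vol (Metric.eball (base x : UniversalCover n x) (ENNReal.ofReal D)) := by
  have hfin := finite_shortClasses (x := x) hL hδ (R + D)
  have hsub : Metric.eball (base x : UniversalCover n x) (ENNReal.ofReal R) ⊆
      ⋃ g ∈ hfin.toFinset, Metric.eball (⟨x, g⟩ : UniversalCover n x) (ENNReal.ofReal D) := by
    intro c hc
    obtain ⟨g, hg⟩ := exists_edist_mk_lt hL hD c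
    refine mem_iUnion₂.2 ⟨g, ?_, hg⟩
    rw [Set.Finite.mem_toFinset]
    refine (edist_triangle _ c _).trans_lt ?_
    rw [ENNReal.ofReal_add hR hD0.le]
    exact ENNReal.add_lt_add (Metric.mem_eball'.1 hc) hg
  refine (measure_mono hsub).trans ((measure_biUnion_finset_le _ _).trans (le_of_eq ?_))
  rw [Finset.sum_congr rfl (fun g _ => vol_eball_mk g _), Finset.sum_const, nsmul_eq_mul,
    Set.ncard_eq_toFinset_card _ hfin]

/-- The counting function is submultiplicative up to a shift: cut a path from the lifted base point
to an orbit point, and join the cutting point to a nearby orbit point. -/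
theorem ncard_shortClasses_add_le [CompactSpace M] (hL : IsLengthSpace M) {δ : ℝ≥0∞}
    (hδ : IsUniformScale n M δ) {D : ℝ} (hD0 : 0 < D)
    (hD : ∀ y z : M, edist y z < ENNReal.ofReal D) {R S : ℝ} (hR : 0 < R) (hS : 0 < S) :
    (shortClasses n x (R + S)).ncard ≤
      (shortClasses n x (R + D)).ncard * (shortClasses n x (S + D)).ncard := by
  have hsub : shortClasses n x (R + S) ⊆
      (fun p : Path.Homotopic.Quotient x x × Path.Homotopic.Quotient x x => p.1.trans p.2) ''
        (shortClasses n x (R + D) ×ˢ shortClasses n x (S + D)) := by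
    intro g hg
    have hg' : edist (base x : UniversalCover n x) ⟨x, g⟩ < _ := hg
    rw [ENNReal.ofReal_add hR.le hS.le] at hg'
    obtain ⟨c, hc1, hc2⟩ := exists_edist_lt_edist_lt (ENNReal.ofReal_pos.2 hR)
      (ENNReal.ofReal_pos.2 hS) hg'
    obtain ⟨h, hh⟩ := exists_edist_mk_lt hL hD c
    refine ⟨(h, h.symm.trans g), ⟨?_, ?_⟩, ?_⟩
    · change displacement n h < _
      rw [ENNReal.ofReal_add hR.le hD0.le]
      exact (edist_triangle _ _ _).trans_lt (ENNReal.add_lt_add hc1 hh)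
    · change displacement n (h.symm.trans g) < _
      rw [← edist_mk_mk, ENNReal.ofReal_add hS.le hD0.le, add_comm]
      exact (edist_triangle_left _ _ c).trans_lt (ENNReal.add_lt_add hh hc2)
    · dsimp only
      rw [← Path.Homotopic.Quotient.trans_assoc, Path.Homotopic.Quotient.trans_symm,
        Path.Homotopic.Quotient.refl_trans]
  have hfin := (finite_shortClasses (x := x) hL hδ (R + D)).prod
    (finite_shortClasses (x := x) hL hδ (S + D))
  calc _ ≤ _ := Set.ncard_le_ncard hsub (hfin.image _)
    _ ≤ _ := Set.ncard_image_le hfin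
    _ = _ := Set.ncard_prod

theorem ncard_shortClasses_mono [CompactSpace M] (hL : IsLengthSpace M) {δ : ℝ≥0∞}
    (hδ : IsUniformScale n M δ) {R S : ℝ} (h : R ≤ S) :
    (shortClasses n x R).ncard ≤ (shortClasses n x S).ncard :=
  Set.ncard_le_ncard (shortClasses_mono h) (finite_shortClasses hL hδ S)

theorem ncard_shortClasses_pos [CompactSpace M] (hL : IsLengthSpace M) {δ : ℝ≥0∞}
    (hδ : IsUniformScale n M δ) {R : ℝ} (hR : 0 < R) : 0 < (shortClasses n x R).ncard :=
  (Set.ncard_pos (finite_shortClasses hL hδ R)).2 ⟨.refl x, by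
    change displacement n _ < _
    rw [displacement_refl]
    exact ENNReal.ofReal_pos.2 hR⟩

end UniversalCover

/-! ### Growth rates -/

theorem tendsto_shift_div {F : ℝ → ℝ} {h : ℝ} (hF : Tendsto (fun R => F R / R) atTop (𝓝 h))
    (c : ℝ) : Tendsto (fun R => F (R + c) / R) atTop (𝓝 h) := by
  have h1 : Tendsto (fun R : ℝ => (R + c) / R) atTop (𝓝 1) := by
    have : Tendsto (fun R : ℝ => 1 + c / R) atTop (𝓝 (1 + 0)) :=
      tendsto_const_nhds.add (tendsto_const_nhds.div_atTop tendsto_id)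
    rw [add_zero] at this
    refine this.congr' ?_
    filter_upwards [eventually_gt_atTop 0] with R hR
    field_simp
  have h2 := (hF.comp (tendsto_atTop_add_const_right atTop c tendsto_id)).mul h1
  rw [mul_one] at h2
  refine h2.congr' ?_
  filter_upwards [eventually_gt_atTop 0, eventually_gt_atTop (-c)] with R hR hRc
  have : R + c ≠ 0 := by linarith
  simp only [Function.comp_apply, id]
  field_simp

/-- Fekete's lemma for functions that are subadditive up to a shift of the arguments. -/
theorem exists_tendsto_div_of_subadditive_shift {F : ℝ → ℝ} {D : ℝ} (hD : 0 < D)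
    (h0 : ∀ R, 0 ≤ F R) (hmono : Monotone F)
    (hsub : ∀ R S, 0 < R → 0 < S → F (R + S) ≤ F (R + D) + F (S + D)) :
    ∃ h : ℝ, Tendsto (fun R => F R / R) atTop (𝓝 h) := by
  -- after a shift by `2 * D` the function is subadditive
  set u : ℕ → ℝ := fun m => F (m + 2 * D) with hu
  have hsa : Subadditive u := by
    intro m k
    have := hsub (m + D) (k + D) (by positivity) (by positivity)
    simp only [hu]
    push_cast
    convert this using 2 <;> ring_nf
  have hlim := hsa.tendsto_lim ⟨0, by
    rintro _ ⟨m, rfl⟩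
    exact div_nonneg (h0 _) (Nat.cast_nonneg m)⟩
  refine ⟨hsa.lim, ?_⟩
  have hfl : Tendsto (fun R : ℝ => ⌊R⌋₊) atTop atTop := tendsto_nat_floor_atTop
  have hlow := (hlim.comp hfl).mul (tendsto_nat_floor_div_atTop (R := ℝ))
  have hup := (hlim.comp ((tendsto_add_atTop_nat 1).comp hfl)).mul
    ((tendsto_nat_floor_div_atTop (R := ℝ)).add (tendsto_inv_atTop_zero (𝕜 := ℝ)))
  simp only [mul_one, add_zero] at hlow hup
  have hG : Tendsto (fun R => F (R + 2 * D) / R) atTop (𝓝 hsa.lim) := by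
    refine tendsto_of_tendsto_of_tendsto_of_le_of_le' hlow hup ?_ ?_
    · filter_upwards [eventually_ge_atTop 1] with R hR
      have hpos : (0 : ℝ) < ⌊R⌋₊ := by exact_mod_cast Nat.floor_pos.2 hR
      have : u ⌊R⌋₊ ≤ F (R + 2 * D) := hmono (by
        have := Nat.floor_le (zero_le_one.trans hR)
        linarith)
      simp only [Function.comp_apply]
      rw [div_mul_div_cancel₀ hpos.ne']
      gcongr
    · filter_upwards [eventually_ge_atTop 1] with R hR
      have hR0 : 0 < R := by linarith
      have : F (R + 2 * D) ≤ u (⌊R⌋₊ + 1) := hmono (by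
        have := (Nat.lt_floor_add_one R).le
        push_cast
        linarith)
      simp only [Function.comp_apply]
      have e : u (⌊R⌋₊ + 1) / ((⌊R⌋₊ + 1 : ℕ) : ℝ) * (⌊R⌋₊ / R + R⁻¹) = u (⌊R⌋₊ + 1) / R := by
        push_cast
        have : (⌊R⌋₊ : ℝ) + 1 ≠ 0 := by positivity
        field_simp
      rw [e]
      gcongr
  have := tendsto_shift_div (F := fun R => F (R + 2 * D)) hG (-(2 * D))
  simpa only [neg_add_cancel_right] using this

/-! ### Free groups are residually finite and Hopfian -/

namespace FreeGroup

/-- Residual finiteness. If `T` is the finite set of elements represented by the suffixes of a word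
for `w`, each generator acts by left multiplication as a partial injection of `T`, which extends to
a permutation of `T`; the resulting action of the free group moves `1` to `w`. -/
theorem exists_hom_perm_ne_one {α : Type*} {w : FreeGroup α} (hw : w ≠ 1) :
    ∃ (T : Finset (FreeGroup α)) (ψ : FreeGroup α →* Equiv.Perm T), ψ w ≠ 1 := by
  classical
  obtain ⟨L, rfl⟩ : ∃ L, FreeGroup.mk L = w := ⟨w.toWord, FreeGroup.mk_toWord⟩
  set T : Finset (FreeGroup α) := (L.tails.map FreeGroup.mk).toFinset with hT
  have hmem : ∀ l, l <:+ L → FreeGroup.mk l ∈ T := fun l hl => by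
    rw [hT, List.mem_toFinset]
    exact List.mem_map_of_mem ((List.mem_tails _ _).2 hl)
  have hext : ∀ i : α, ∃ τ : Equiv.Perm T, ∀ t : T, FreeGroup.of i * t ∈ T →
      (τ t : FreeGroup α) = FreeGroup.of i * t := fun i => by
    obtain ⟨g, hg⟩ := Set.MapsTo.exists_equiv_extend_of_card_eq (α := T) (t := T)
      (by simp) (s := {t : T | FreeGroup.of i * t ∈ T}) (f := fun t => FreeGroup.of i * t)
      (fun t ht => ht) (fun a _ b _ hab => Subtype.ext (mul_left_cancel hab))
    exact ⟨g, fun t ht => hg t ht⟩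
  choose τ hτ using hext
  have h1 : (1 : FreeGroup α) ∈ T := hmem [] (List.nil_suffix)
  have key : ∀ l, l <:+ L → (FreeGroup.lift τ (FreeGroup.mk l) ⟨1, h1⟩ : FreeGroup α) =
      FreeGroup.mk l := by
    intro l
    induction l with
    | nil => intro _; rfl
    | cons a l ih =>
      intro hl
      have hl' : l <:+ L := (List.suffix_cons a l).trans hl
      obtain ⟨i, b⟩ := a
      have hsplit : FreeGroup.mk ((i, b) :: l) = FreeGroup.mk [(i, b)] * FreeGroup.mk l := by
        rw [FreeGroup.mul_mk]; rfl
      have ih' : FreeGroup.lift τ (FreeGroup.mk l) ⟨1, h1⟩ = ⟨FreeGroup.mk l, hmem l hl'⟩ :=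
        Subtype.ext (ih hl')
      rw [hsplit, _root_.map_mul, Equiv.Perm.mul_apply, ih']
      have hm := hmem _ hl
      rw [hsplit] at hm
      cases b with
      | true =>
        have : FreeGroup.lift τ (FreeGroup.mk [(i, true)]) = τ i := FreeGroup.lift_apply_of
        rw [this]
        exact hτ i _ hm
      | false =>
        have e : FreeGroup.mk [(i, false)] = (FreeGroup.of i)⁻¹ := rfl
        rw [e] at hm ⊢
        rw [_root_.map_inv, FreeGroup.lift_apply_of]
        have : τ i ⟨_, hm⟩ = ⟨FreeGroup.mk l, hmem l hl'⟩ := by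
          refine Subtype.ext ((hτ i ⟨_, hm⟩ ?_).trans ?_)
          · simpa using hmem l hl'
          · simp
        rw [← this]
        exact congrArg Subtype.val ((τ i).symm_apply_apply _)
  refine ⟨T, FreeGroup.lift τ, fun h => hw ?_⟩
  rw [← key L (List.suffix_refl L), h]
  rfl

/-- A free group of finite rank is Hopfian. Precomposition with a surjective endomorphism `f` is
injective, hence surjective, on the finite set of homomorphisms to a finite group, so every
homomorphism to a finite group kills the kernel of `f`. -/
theorem injective_of_surjective_endomorphism {α : Type*} [Finite α]
    {f : FreeGroup α →* FreeGroup α} (hf : Function.Surjective f) : Function.Injective f := by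
  rw [injective_iff_map_eq_one]
  intro g hg
  by_contra hne
  obtain ⟨T, ψ, hψ⟩ := exists_hom_perm_ne_one hne
  have : Finite (FreeGroup α →* Equiv.Perm T) := Finite.of_equiv _ FreeGroup.lift
  have hinj : Function.Injective fun θ : FreeGroup α →* Equiv.Perm T => θ.comp f :=
    fun θ₁ θ₂ h => (MonoidHom.cancel_right hf).1 h
  obtain ⟨θ, hθ⟩ := Finite.surjective_of_injective hinj ψ
  apply hψ
  rw [← hθ]
  simp [hg]

/-- Elements of a group, as many as the rank of the free group that they generate, generate it
freely. -/
theorem lift_injective_of_closure_mulEquiv {α G : Type*} [Finite α] [Group G] (c : α → G)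
    (e : Subgroup.closure (Set.range c) ≃* FreeGroup α) :
    Function.Injective (FreeGroup.lift c) := by
  set c' : α → Subgroup.closure (Set.range c) := fun i =>
    ⟨c i, Subgroup.subset_closure ⟨i, rfl⟩⟩
  have hval : (Subgroup.subtype _).comp (FreeGroup.lift c') = FreeGroup.lift c :=
    FreeGroup.ext_hom _ _ fun i => by simp [c']
  have hsurj : Function.Surjective (FreeGroup.lift c') := by
    rintro ⟨y, hy⟩
    rw [← FreeGroup.range_lift_eq_closure] at hy
    obtain ⟨w, rfl⟩ := hy
    exact ⟨w, Subtype.ext (DFunLike.congr_fun hval w)⟩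
  have hinj : Function.Injective ((e : _ →* FreeGroup α).comp (FreeGroup.lift c')) :=
    injective_of_surjective_endomorphism (e.surjective.comp hsurj)
  rw [← hval]
  exact (Subgroup.subtype_injective _).comp (Function.Injective.of_comp hinj)

/-! ### Summable weights on a free group -/

/-- If prefixing the letter `i` or its inverse decreases the weight `f` at most by the factor `z i`
and the total weight is finite, then `∑ z i / (1 + z i) < 1 / 2`. The weights `W a` of the words
with first letter `a` satisfy `W a ≥ z i * (W - W a⁻¹)`, because `a * w` starts with `a` unless `w`
starts with `a⁻¹`; together with `∑ W a < W` this gives the inequality. -/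
theorem sum_div_one_add_lt_of_tsum_ne_top {α : Type*} [Fintype α] {f : FreeGroup α → ℝ≥0∞}
    {z : α → ℝ} (hz : ∀ i, 0 ≤ z i) (hf : f 1 ≠ 0) (hsum : ∑' w, f w ≠ ⊤)
    (hmul : ∀ i b w, ENNReal.ofReal (z i) * f w ≤ f (FreeGroup.mk [(i, b)] * w)) :
    ∑ i, z i / (1 + z i) < 1 / 2 := by
  classical
  set W := ∑' w, f w with hW
  set V : α × Bool → ℝ≥0∞ := fun a => ∑' w, (startsWith a).indicator f w with hV
  have hVW : ∀ a, V a ≤ W := fun a => ENNReal.tsum_le_tsum fun w => indicator_le_self _ _ _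
  have hVtop : ∀ a, V a ≠ ⊤ := fun a => ne_top_of_le_ne_top hsum (hVW a)
  have hstep : ∀ i b, ENNReal.ofReal (z i) * W ≤
      V (i, b) + ENNReal.ofReal (z i) * V (i, !b) := by
    intro i b
    have hsplit : W = V (i, !b) + ∑' w : ((startsWith (i, !b))ᶜ : Set (FreeGroup α)), f w := by
      rw [hV]
      dsimp only
      rw [← tsum_subtype]
      exact (ENNReal.summable.tsum_add_tsum_compl ENNReal.summable).symm
    rw [hsplit, mul_add, add_comm]
    gcongr
    rw [← ENNReal.tsum_mul_left, hV]
    dsimp only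
    rw [← tsum_subtype]
    set j : ((startsWith (i, !b))ᶜ : Set (FreeGroup α)) → startsWith (i, b) := fun w =>
      ⟨FreeGroup.mk [(i, b)] * w, startsWith_mk_mul (w := (i, b)) _ w.2⟩
    have hj : Function.Injective j := fun w₁ w₂ h =>
      Subtype.ext (mul_left_cancel (congrArg Subtype.val h))
    calc _ ≤ ∑' w, f (j w) := ENNReal.tsum_le_tsum fun w => hmul i b w
      _ ≤ _ := ENNReal.tsum_comp_le_tsum_of_injective hj fun w => f w
  have htotal : f 1 + ∑ a, V a ≤ W := by
    have h1 : f 1 = ∑' w, ({1} : Set (FreeGroup α)).indicator f w := by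
      rw [← tsum_subtype, tsum_singleton]
    rw [h1, ← Summable.tsum_finsetSum (fun _ _ => ENNReal.summable), ← ENNReal.tsum_add]
    refine ENNReal.tsum_le_tsum fun w => ?_
    by_cases hw : w = 1
    · subst hw
      rw [indicator_of_mem (mem_singleton _), Finset.sum_eq_zero, add_zero]
      exact fun a _ => indicator_of_notMem (fun h => startsWith.ne_one _ h rfl) _
    · rw [indicator_of_notMem (by simpa using hw), zero_add]
      by_cases hex : ∃ a, w ∈ startsWith a
      · obtain ⟨a, ha⟩ := hex
        rw [Finset.sum_eq_single a]
        · exact indicator_le_self _ _ _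
        · intro b _ hba
          exact indicator_of_notMem
            ((startsWith.disjoint_iff_ne.2 hba.symm).notMem_of_mem_left ha) _
        · simp
      · push Not at hex
        rw [Finset.sum_eq_zero fun a _ => indicator_of_notMem (hex a) _]
        exact bot_le
  have hf1 : f 1 ≠ ⊤ := ne_top_of_le_ne_top hsum (ENNReal.le_tsum 1)
  have hreal : ∀ i b, z i * W.toReal ≤ (V (i, b)).toReal + z i * (V (i, !b)).toReal := by
    intro i b
    have h := ENNReal.toReal_mono (ENNReal.add_ne_top.2
      ⟨hVtop _, ENNReal.mul_ne_top ENNReal.ofReal_ne_top (hVtop _)⟩) (hstep i b)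
    rwa [ENNReal.toReal_add (hVtop _) (ENNReal.mul_ne_top ENNReal.ofReal_ne_top (hVtop _)),
      ENNReal.toReal_mul, ENNReal.toReal_mul, ENNReal.toReal_ofReal (hz i)] at h
  have hpair : ∀ i, 2 * W.toReal * (z i / (1 + z i)) ≤
      (V (i, true)).toReal + (V (i, false)).toReal := by
    intro i
    have hpos : 0 < 1 + z i := by linarith [hz i]
    rw [mul_div_assoc', div_le_iff₀ hpos]
    have h1 := hreal i true
    have h2 := hreal i false
    simp only [Bool.not_true, Bool.not_false] at h1 h2
    linarith
  have htot : (f 1).toReal + ∑ i, ((V (i, true)).toReal + (V (i, false)).toReal) ≤ W.toReal := by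
    have h := ENNReal.toReal_mono hsum htotal
    rw [ENNReal.toReal_add hf1 (ENNReal.sum_ne_top.2 fun a _ => hVtop a),
      ENNReal.toReal_sum fun a _ => hVtop a, Fintype.sum_prod_type] at h
    simpa using h
  have hle : (f 1).toReal + 2 * W.toReal * ∑ i, z i / (1 + z i) ≤ W.toReal := by
    rw [Finset.mul_sum]
    exact (add_le_add le_rfl (Finset.sum_le_sum fun i _ => hpair i)).trans htot
  have hf1pos : 0 < (f 1).toReal := ENNReal.toReal_pos hf hf1
  have hWpos : 0 < W.toReal := hf1pos.trans_le
    (ENNReal.toReal_mono hsum (ENNReal.le_tsum 1))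
  by_contra! hge
  nlinarith

end FreeGroup

/-- A Poincaré series converges beyond the exponential growth rate of its counting function. -/
theorem tsum_ofReal_exp_neg_mul_ne_top {ι : Type*} {ℓ : ι → ℝ} (hℓ : ∀ i, 0 ≤ ℓ i) {N : ℝ → ℕ}
    (hN : ∀ R, {i | ℓ i < R}.encard ≤ N R) {h s : ℝ} (hs : h < s) (hs0 : 0 ≤ s)
    (hlim : Tendsto (fun R => Real.log (N R) / R) atTop (𝓝 h)) :
    ∑' i, ENNReal.ofReal (Real.exp (-s * ℓ i)) ≠ ⊤ := by
  obtain ⟨t, ht1, ht2⟩ := exists_between hs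
  have hev : ∀ᶠ R : ℝ in atTop, (N R : ℝ) ≤ Real.exp (t * R) := by
    filter_upwards [hlim.eventually_lt_const ht1, eventually_gt_atTop 0] with R hR hR0
    rw [div_lt_iff₀ hR0] at hR
    exact (Real.le_exp_log _).trans (Real.exp_le_exp.2 hR.le)
  have hsummable : Summable fun m : ℕ => (N (m + 1) : ℝ) * Real.exp (-s * m) := by
    have hg : Summable fun m : ℕ => Real.exp t * Real.exp (-(s - t)) ^ m :=
      (summable_geometric_of_lt_one (Real.exp_pos _).le
        (Real.exp_lt_one_iff.2 (by linarith))).mul_left _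
    refine Summable.of_norm_bounded_eventually_nat hg ?_
    have hev' : ∀ᶠ m : ℕ in atTop, (N ((m : ℝ) + 1) : ℝ) ≤ Real.exp (t * (m + 1)) :=
      (tendsto_atTop_add_const_right atTop (1 : ℝ) tendsto_natCast_atTop_atTop).eventually hev
    filter_upwards [hev'] with m hm
    rw [Real.norm_of_nonneg (by positivity)]
    calc _ ≤ Real.exp (t * (m + 1)) * Real.exp (-s * m) := by gcongr
      _ = _ := by rw [← Real.exp_nat_mul, ← Real.exp_add, ← Real.exp_add]; ring_nf
  have hterm : ∀ i, ENNReal.ofReal (Real.exp (-s * ℓ i)) ≤ ∑' m : ℕ,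
      {i | ⌊ℓ i⌋₊ = m}.indicator (fun _ => ENNReal.ofReal (Real.exp (-s * m))) i := fun i => by
    refine le_trans ?_ (ENNReal.le_tsum ⌊ℓ i⌋₊)
    rw [indicator_of_mem (by simp)]
    refine ENNReal.ofReal_le_ofReal (Real.exp_le_exp.2 ?_)
    have := mul_le_mul_of_nonneg_left (Nat.floor_le (hℓ i)) hs0
    linarith
  refine ne_top_of_le_ne_top hsummable.tsum_ofReal_ne_top
    ((ENNReal.tsum_le_tsum hterm).trans ?_)
  rw [ENNReal.tsum_comm]
  refine ENNReal.tsum_le_tsum fun m => ?_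
  rw [← tsum_subtype, ENNReal.tsum_set_const, ENNReal.ofReal_mul (Nat.cast_nonneg _),
    ENNReal.ofReal_natCast]
  gcongr
  have hsub : {i | ⌊ℓ i⌋₊ = m} ⊆ {i | ℓ i < (m : ℝ) + 1} := by
    rintro i rfl
    exact Nat.lt_floor_add_one (ℓ i)
  exact_mod_cast (encard_le_encard hsub).trans (hN _)

/-! ### Volume entropy and the growth of the fundamental group -/

/-- A function squeezed, up to constants and shifts of the argument, by a counting function has the
same exponential growth rate. -/
theorem tendsto_log_div_of_le_of_le {V : ℝ → ℝ≥0∞} {N : ℝ → ℕ} {h a b : ℝ} {v₀ v₁ : ℝ≥0∞}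
    (hlim : Tendsto (fun R => Real.log (N R) / R) atTop (𝓝 h)) (hN : ∀ R, 0 < R → 0 < N R)
    (hv₀ : 0 < v₀) (hv₁ : 0 < v₁) (hv₁' : v₁ < ⊤)
    (hlow : ∀ᶠ R in atTop, N (R + a) * v₀ ≤ V R) (hup : ∀ᶠ R in atTop, V R ≤ N (R + b) * v₁) :
    Tendsto (fun R : ℝ => ENNReal.log (V R) / (R : EReal)) atTop (𝓝 (h : EReal)) := by
  have hpos : ∀ᶠ R : ℝ in atTop, 0 < R ∧ 0 < N (R + a) ∧ 0 < N (R + b) := by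
    filter_upwards [eventually_gt_atTop 0, eventually_gt_atTop (-a), eventually_gt_atTop (-b)]
      with R h0 h1 h2
    exact ⟨h0, hN _ (by linarith), hN _ (by linarith)⟩
  have hVtop : ∀ᶠ R in atTop, V R ≠ ⊤ := by
    filter_upwards [hup] with R hR
    exact ne_top_of_le_ne_top (ENNReal.mul_ne_top (ENNReal.natCast_ne_top _) hv₁'.ne) hR
  have hlim' : ∀ (c : ℝ) (v : ℝ≥0∞), Tendsto
      (fun R => (Real.log (N (R + c)) + Real.log v.toReal) / R) atTop (𝓝 h) := fun c v => by
    have := (tendsto_shift_div (F := fun R => Real.log (N R)) hlim c).add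
      (tendsto_const_nhds (x := Real.log v.toReal).div_atTop tendsto_id)
    rw [add_zero] at this
    refine this.congr fun R => ?_
    simp only [id, add_div]
  have hreal : Tendsto (fun R => Real.log (V R).toReal / R) atTop (𝓝 h) := by
    refine tendsto_of_tendsto_of_tendsto_of_le_of_le' (hlim' a v₀) (hlim' b v₁) ?_ ?_
    · filter_upwards [hpos, hlow, hVtop] with R ⟨h0, h1, _⟩ hR hRtop
      have hv : v₀ ≠ ⊤ := by
        rintro rfl
        rw [ENNReal.mul_top (by exact_mod_cast h1.ne')] at hR
        exact hRtop (top_le_iff.1 hR)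
      have h1' : (0 : ℝ) < N (R + a) := by exact_mod_cast h1
      rw [← Real.log_mul h1'.ne' (ENNReal.toReal_pos hv₀.ne' hv).ne']
      have hpos' : 0 < (N (R + a) : ℝ) * v₀.toReal := mul_pos h1' (ENNReal.toReal_pos hv₀.ne' hv)
      have := ENNReal.toReal_mono hRtop hR
      rw [ENNReal.toReal_mul, ENNReal.toReal_natCast] at this
      gcongr
    · filter_upwards [hpos, hlow, hup, hVtop] with R ⟨h0, h1, h2⟩ hR hR' hRtop
      have h2' : (0 : ℝ) < N (R + b) := by exact_mod_cast h2
      rw [← Real.log_mul h2'.ne' (ENNReal.toReal_pos hv₁.ne' hv₁'.ne).ne']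
      have hVpos : 0 < V R :=
        (ENNReal.mul_pos (by exact_mod_cast h1.ne') hv₀.ne').trans_le hR
      have := ENNReal.toReal_mono (ENNReal.mul_ne_top (ENNReal.natCast_ne_top _) hv₁'.ne) hR'
      rw [ENNReal.toReal_mul, ENNReal.toReal_natCast] at this
      have := ENNReal.toReal_pos hVpos.ne' hRtop
      gcongr
  refine ((continuous_coe_real_ereal.tendsto h).comp hreal).congr' ?_
  filter_upwards [hpos, hlow, hVtop] with R ⟨_, h1, _⟩ hR hRtop
  have hVpos : 0 < V R := (ENNReal.mul_pos (by exact_mod_cast h1.ne') hv₀.ne').trans_le hR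
  have hlog : ENNReal.log (V R) = (Real.log (V R).toReal : EReal) := by
    conv_lhs => rw [← ENNReal.ofReal_toReal hRtop]
    rw [ENNReal.log_ofReal, if_neg (not_le.2 (ENNReal.toReal_pos hVpos.ne' hRtop))]
  rw [hlog, ← EReal.coe_div]
  rfl

namespace UniversalCover

variable {n : ℕ} {M : Type*} [EMetricSpace M] [ChartedSpace (EuclideanSpace ℝ (Fin n)) M] {x : M}

/-- The volume entropy exists and equals the growth rate of the number of short loop classes. -/
theorem exists_tendsto_and_hasVolumeEntropy [CompactSpace M] [ConnectedSpace M]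
    (hL : IsLengthSpace M) {δ : ℝ≥0∞} (hδ : IsUniformScale n M δ) (x : M) :
    ∃ h : ℝ, Tendsto (fun R => Real.log (shortClasses n x R).ncard / R) atTop (𝓝 h) ∧
      HasVolumeEntropy n M h := by
  obtain ⟨D, hD0, hD⟩ := exists_forall_edist_lt_ofReal M
  obtain ⟨h, hh⟩ := exists_tendsto_div_of_subadditive_shift
    (F := fun R => Real.log (shortClasses n x R).ncard) hD0
    (fun R => Real.log_natCast_nonneg _)
    (fun R S hRS => by
      dsimp only
      rcases Nat.eq_zero_or_pos (shortClasses n x R).ncard with h0 | h0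
      · rw [h0, Nat.cast_zero, Real.log_zero]
        exact Real.log_natCast_nonneg _
      · exact Real.log_le_log (by exact_mod_cast h0)
          (by exact_mod_cast ncard_shortClasses_mono hL hδ hRS))
    (fun R S hR hS => by
      have hpos : ∀ {T : ℝ}, 0 < T → (0 : ℝ) < (shortClasses n x T).ncard := fun hT => by
        exact_mod_cast ncard_shortClasses_pos hL hδ hT
      rw [← Real.log_mul (hpos (by linarith)).ne' (hpos (by linarith)).ne']
      exact Real.log_le_log (hpos (by linarith))
        (by exact_mod_cast ncard_shortClasses_add_le hL hδ hD0 hD hR hS))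
  refine ⟨h, hh, fun x' p => ?_⟩
  -- move `p` by an isometry to a point `q` of the cover with base point `x`, close to its base
  obtain ⟨γ, hγ⟩ := hL (hD x p.proj)
  set q : UniversalCover n x :=
    translate ((Path.Homotopic.Quotient.mk γ).trans p.cls.symm) p with hq
  have hqD : edist (base x) q < ENNReal.ofReal D := by
    have hcls : (Path.Homotopic.Quotient.refl x).trans (.mk γ) =
        ((Path.Homotopic.Quotient.mk γ).trans p.cls.symm).trans p.cls := by
      rw [Path.Homotopic.Quotient.trans_assoc, Path.Homotopic.Quotient.symm_trans,
        Path.Homotopic.Quotient.trans_refl, Path.Homotopic.Quotient.refl_trans]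
    exact (edist_le_pathLength (a := (base x : UniversalCover n x)) (b := q) γ hcls).trans_lt hγ
  set r := (δ / 3).toReal with hr
  have hr' : ENNReal.ofReal r = δ / 3 :=
    ENNReal.ofReal_toReal (ENNReal.div_ne_top hδ.ne_top (by simp))
  have h3 : 3 * ENNReal.ofReal r ≤ δ := by
    rw [hr']
    exact (ENNReal.mul_div_cancel (by simp) (by simp)).le
  have hrpos : 0 < ENNReal.ofReal r := by
    rw [hr']
    exact ENNReal.div_pos hδ.pos.ne' (by simp)
  refine tendsto_log_div_of_le_of_le (a := -(D + r)) (b := D + D) hh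
    (fun R hR => ncard_shortClasses_pos hL hδ hR) (vol_eball_pos hL hδ hrpos (base x))
    (vol_eball_pos hL hδ (ENNReal.ofReal_pos.2 hD0) (base x))
    (vol_eball_lt_top hL hδ (base x) ENNReal.ofReal_ne_top) ?_ ?_
  · filter_upwards [eventually_ge_atTop (D + r)] with R hR
    refine (ncard_shortClasses_mul_vol_le hL hδ (by linarith) ENNReal.toReal_nonneg h3).trans ?_
    rw [← vol_eball_translate ((Path.Homotopic.Quotient.mk γ).trans p.cls.symm) p]
    refine measure_mono fun c hc => ?_
    have hR' : ENNReal.ofReal R = ENNReal.ofReal (R + -(D + r) + r) + ENNReal.ofReal D := by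
      rw [← ENNReal.ofReal_add (by linarith [ENNReal.toReal_nonneg (a := δ / 3)]) hD0.le]
      congr 1
      ring
    rw [Metric.mem_eball, hR']
    exact (edist_triangle _ _ _).trans_lt (ENNReal.add_lt_add hc hqD)
  · filter_upwards [eventually_ge_atTop 0] with R hR
    rw [← add_assoc]
    refine le_trans ?_ (vol_eball_le_ncard_shortClasses_mul hL hδ hD0 hD (by linarith))
    rw [← vol_eball_translate ((Path.Homotopic.Quotient.mk γ).trans p.cls.symm) p]
    refine measure_mono fun c hc => ?_
    rw [Metric.mem_eball, ENNReal.ofReal_add hR hD0.le]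
    rw [edist_comm] at hqD
    exact (edist_triangle _ _ _).trans_lt (ENNReal.add_lt_add hc hqD)

theorem displacement_mul_le (p q : FundamentalGroup M x) :
    displacement n (FundamentalGroup.toPath (p * q)) ≤
      displacement n p.toPath + displacement n q.toPath :=
  (displacement_trans_le (n := n) q.toPath p.toPath).trans_eq (add_comm _ _)

theorem displacement_inv (p : FundamentalGroup M x) :
    displacement n (FundamentalGroup.toPath p⁻¹) = displacement n p.toPath :=
  displacement_symm (n := n) p.toPath

/-- The inequality for an exponent above the growth rate of the fundamental group. -/
theorem sum_one_div_one_add_exp_lt [CompactSpace M] (hL : IsLengthSpace M) {δ : ℝ≥0∞}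
    (hδ : IsUniformScale n M δ) {k : ℕ} (c : Fin k → Path x x)
    (hlength : ∀ i, pathLength (c i) ≠ ⊤) (hindep : HomotopicallyIndependent c) {h s : ℝ}
    (hs0 : 0 ≤ s) (hs : h < s)
    (hlim : Tendsto (fun R => Real.log (shortClasses n x R).ncard / R) atTop (𝓝 h)) :
    ∑ i, 1 / (1 + Real.exp (s * (pathLength (c i)).toReal)) < 1 / 2 := by
  obtain ⟨e⟩ := hindep
  set g : Fin k → FundamentalGroup M x := fun i =>
    FundamentalGroup.fromPath (Path.Homotopic.Quotient.mk (c i)) with hg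
  have hinj : Function.Injective (FreeGroup.lift g) :=
    FreeGroup.lift_injective_of_closure_mulEquiv g e
  set d : FreeGroup (Fin k) → ℝ≥0∞ := fun w =>
    displacement n (FundamentalGroup.toPath (FreeGroup.lift g w)) with hd
  have hgen : ∀ i b, d (FreeGroup.mk [(i, b)]) ≤ pathLength (c i) := by
    intro i b
    cases b with
    | true =>
      have e1 : FreeGroup.lift g (FreeGroup.mk [(i, true)]) = g i := FreeGroup.lift_apply_of
      simp only [hd, e1]
      exact displacement_mk_le (c i)
    | false =>
      have e1 : FreeGroup.lift g (FreeGroup.mk [(i, false)]) = (g i)⁻¹ := by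
        have : FreeGroup.mk [(i, false)] = (FreeGroup.of i)⁻¹ := rfl
        rw [this, _root_.map_inv, FreeGroup.lift_apply_of]
      simp only [hd, e1]
      rw [displacement_inv]
      exact displacement_mk_le (c i)
  have hmul : ∀ v w, d (v * w) ≤ d v + d w := fun v w => by
    simp only [hd, _root_.map_mul]
    exact displacement_mul_le _ _
  have hone : d 1 = 0 := by
    simp only [hd, _root_.map_one]
    exact displacement_refl
  have hfin : ∀ w, d w ≠ ⊤ := by
    intro w
    obtain ⟨L, rfl⟩ : ∃ L, FreeGroup.mk L = w := ⟨w.toWord, FreeGroup.mk_toWord⟩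
    induction L with
    | nil => exact hone.trans_ne ENNReal.zero_ne_top
    | cons a L ih =>
      have hsplit : FreeGroup.mk (a :: L) = FreeGroup.mk [a] * FreeGroup.mk L := by
        rw [FreeGroup.mul_mk]; rfl
      rw [hsplit]
      exact ne_top_of_le_ne_top (ENNReal.add_ne_top.2
        ⟨ne_top_of_le_ne_top (hlength a.1) (hgen a.1 a.2), ih⟩) (hmul _ _)
  have hcount : ∀ R, {w | (d w).toReal < R}.encard ≤ (shortClasses n x R).ncard := by
    intro R
    rw [(finite_shortClasses (x := x) hL hδ R).cast_ncard_eq]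
    refine encard_le_encard_of_injOn (f := fun w => FundamentalGroup.toPath (FreeGroup.lift g w))
      (fun w hw => ?_) hinj.injOn
    exact (ENNReal.lt_ofReal_iff_toReal_lt (hfin w)).2 hw
  have hseries := tsum_ofReal_exp_neg_mul_ne_top (ℓ := fun w => (d w).toReal)
    (fun _ => ENNReal.toReal_nonneg) hcount hs hs0 hlim
  have hmain := FreeGroup.sum_div_one_add_lt_of_tsum_ne_top
    (z := fun i => Real.exp (-s * (pathLength (c i)).toReal)) (fun i => (Real.exp_pos _).le)
    (ENNReal.ofReal_pos.2 (Real.exp_pos _)).ne' hseries (fun i b w => by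
      rw [← ENNReal.ofReal_mul (Real.exp_pos _).le, ← Real.exp_add]
      refine ENNReal.ofReal_le_ofReal (Real.exp_le_exp.2 ?_)
      have h1 : (d (FreeGroup.mk [(i, b)] * w)).toReal ≤
          (pathLength (c i)).toReal + (d w).toReal := by
        rw [← ENNReal.toReal_add (hlength i) (hfin w)]
        exact ENNReal.toReal_mono (ENNReal.add_ne_top.2 ⟨hlength i, hfin w⟩)
          ((hmul _ _).trans (add_le_add (hgen i b) le_rfl))
      have := mul_le_mul_of_nonneg_left h1 hs0
      linarith)
  refine lt_of_eq_of_lt (Finset.sum_congr rfl fun i _ => ?_) hmain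
  have hpos := Real.exp_pos (s * (pathLength (c i)).toReal)
  rw [neg_mul, Real.exp_neg]
  field_simp
  ring

end UniversalCover

theorem corollary2 {n : ℕ} {M : Type*} [EMetricSpace M]
    [ChartedSpace (EuclideanSpace ℝ (Fin n)) M] [IsManifold (𝓡 n) ∞ M]
    [RiemannianBundle (fun x : M => TangentSpace (𝓡 n) x)]
    [IsContMDiffRiemannianBundle (𝓡 n) ∞ (EuclideanSpace ℝ (Fin n))
      (fun x : M => TangentSpace (𝓡 n) x)]
    [IsRiemannianManifold (𝓡 n) M] [CompactSpace M] [ConnectedSpace M]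
    {k : ℕ} {x : M} (c : Fin k → Path x x)
    (hlength : ∀ i, pathLength (c i) ≠ ⊤)
    (hindep : HomotopicallyIndependent c) :
    ∃ h : ℝ, HasVolumeEntropy n M h ∧
      ∑ i, 1 / (1 + Real.exp (h * (pathLength (c i)).toReal)) ≤ 1 / 2 := by
  have : IsManifold (𝓡 n) 1 M := .of_le (n := ∞) (by simp)
  have : IsContinuousRiemannianBundle (EuclideanSpace ℝ (Fin n))
      (fun x : M => TangentSpace (𝓡 n) x) := by
    obtain ⟨g, hg, hg'⟩ := IsContMDiffRiemannianBundle.exists_contMDiff (IB := 𝓡 n) (n := ∞)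
      (F := EuclideanSpace ℝ (Fin n)) (E := fun x : M => TangentSpace (𝓡 n) x)
    exact ⟨g, hg.continuous, hg'⟩
  have hL := isLengthSpace_of_isRiemannianManifold n M
  obtain ⟨δ, hδ⟩ := exists_isUniformScale n M
  obtain ⟨h, hlim, hvol⟩ := UniversalCover.exists_tendsto_and_hasVolumeEntropy hL hδ x
  refine ⟨h, hvol, ?_⟩
  have h0 : 0 ≤ h := ge_of_tendsto hlim (by
    filter_upwards [eventually_ge_atTop 0] with R hR
    exact div_nonneg (Real.log_natCast_nonneg _) hR)
  have hcont : Continuous fun s : ℝ =>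
      ∑ i, 1 / (1 + Real.exp (s * (pathLength (c i)).toReal)) :=
    continuous_finsetSum _ fun i _ => continuous_const.div (by fun_prop) fun s => by positivity
  refine le_of_tendsto ((hcont.tendsto h).mono_left (nhdsWithin_le_nhds (s := Ioi h))) ?_
  filter_upwards [self_mem_nhdsWithin] with s hs
  exact (UniversalCover.sum_one_div_one_add_exp_lt hL hδ c hlength hindep
    (h0.trans (le_of_lt hs)) hs hlim).le
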